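/- Let $n\ge 1$, $s\in(0,1)$, $\gamma\in(0,1]$ with $n\neq 2s$, let $\Omega\subset\mathbb R^n$ be a non-empty bounded open set, and put $\delta(x)=\operatorname{dist}(x,\partial\Omega)$. Let $L^1(\Omega;\delta^\gamma)$ be the space of measurable $f$ on $\Omega$ with $\int_\Omega|f|\,\delta^\gamma\,dx<\infty$, and let $\delta^\gamma L^\infty(\Omega)$ be the set of measurable $\psi$ on $\Omega$ with $|\psi|\le C\delta^\gamma$ a.e. in $\Omega$ for some constant $C$. Let $\mathcal L:\operatorname{dom}\mathcal L\subset L^2(\Omega)\to L^2(\Omega)$ be a linear operator with $\langle\mathcal Lu,u\rangle\ge0$ for all $u\in\operatorname{dom}\mathcal L$, satisfying the following assumption (K1): $\mathcal L$ has a Green's function, that is, there is a measurable function $\mathcal G_0:\{(x,y)\in\Omega\times\Omega:x\ne y\}\to(0,\infty)$ such that the operator $$\mathbb G_0(f)(x)=\int_\Omega\mathcal G_0(x,y)f(y)\,dy$$ on $L^2(\Omega)$ is the two-sided inverse of $\mathcal L$ (in particular $\operatorname{dom}\mathcal L=\mathbb G_0(L^2(\Omega))$); moreover $\mathcal G_0(x,y)=\mathcal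 G_0(y,x)$, and there is $C>0$ with $C^{-1}k\le \mathcal G_0\le Ck$ for all $x\neq y$ in $\Omega$, where $$k(x,y)=\frac1{|x-y|^{n-2s}}\Big(\frac{\delta(x)^\gamma}{|x-y|^\gamma}\wedge1\Big)\Big(\frac{\delta(y)^\gamma}{|x-y|^\gamma}\wedge1\Big).$$ Then $\mathbb G_0(g)(x)$ is given by an absolutely convergent integral for a.e. $x\in\Omega$, for every $g\in L^1(\Omega;\delta^\gamma)$, and $L^2(\Omega)$ has an orthonormal basis $(\varphi_j)_{j\ge1}$ of eigenfunctions of $\mathcal L$, $\mathcal L\varphi_j=\lambda_j\varphi_j$, with $0<\lambda_1\le\lambda_2\le\cdots\nearrow+\infty$. Fix any such basis and any $\lambda\in\mathbb R\setminus\{\lambda_j:j\ge1\}$. Then the series $$\mathbb G_\lambda(g)=\sum_{j\ge1}\frac{\langle g,\varphi_j\rangle}{\lambda_j-\lambda}\varphi_j$$ converges in $L^2(\Omega)$ for every $g\in L^2(\Omega)$, and the operator $\mathbb G_\lambda$ has a unique extension to a bounded linear operator, still denoted $\mathbb G_\lambda$, from $L^1(\Omega;\delta^\gamma)$ to itself.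 For all $f,u\in L^1(\Omega;\delta^\gamma)$ the following five notions of solution of $\mathcal Lu-\lambda u=f$ in $\Omega$, with zero boundary data, are equivalent: 1. ($\mathbb G_\lambda$-Green solution) $u=\mathbb G_\lambda(f)$ a.e. in $\Omega$; 2. ($\mathbb G_\lambda(\delta^\gamma L^\infty)$-weak solution) $\int_\Omega u\psi\,dx=\int_\Omega f\,\mathbb G_\lambda(\psi)\,dx$ for all $\psi\in\delta^\gamma L^\infty(\Omega)$; 3. ($\mathbb G_0(L^\infty_c)$-weak solution) $\int_\Omega u(\psi-\lambda\mathbb G_0(\psi))\,dx=\int_\Omega f\,\mathbb G_0(\psi)\,dx$ for all bounded measurable $\psi$ with compact support in $\Omega$; 4. ($\mathbb G_0(C^\infty_c)$-weak solution) the identity in 3 holds for all $\psi\in C_c^\infty(\Omega)$; 5. ($\mathbb G_0$-Green solution) $u=\lambda\mathbb G_0(u)+\mathbb G_0(f)$ a.e. in $\Omega$. Here the validity of an identity includes the absolute convergence of the integrals in it. If in addition $f\in L^2(\Omega)$ and $u\in\mathbb H^2_{\mathcal L}(\Omega)=\{v\in L^2(\Omega):\sum_{j}\lambda_j^2\langle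 v,\varphi_j\rangle^2<\infty\}$, then each of 1–5 is also equivalent to 6. (spectral solution) $(\lambda_j-\lambda)\int_\Omega u\varphi_j\,dx=\int_\Omega f\varphi_j\,dx$ for all $j\ge1$. -/

import Mathlib

open MeasureTheory Filter Topology Set
open scoped ContDiff ENNReal

namespace GreenNotions

noncomputable section

/-- `ℝⁿ` with the Euclidean norm. -/
abbrev E (n : ℕ) : Type := EuclideanSpace ℝ (Fin n)

variable {n : ℕ}

/-- The distance `δ(x) = dist(x, ∂Ω)`. -/
def bdist (Ω : Set (E n)) (x : E n) : ℝ := Metric.infDist x (frontier Ω)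

/-- `L²(Ω)`. -/
abbrev L2 (Ω : Set (E n)) : Type := Lp ℝ 2 (volume.restrict Ω)

/-- The measure `δ(x)^γ dx` on `Ω`. -/
def weightedMeasure (Ω : Set (E n)) (γ : ℝ) : Measure (E n) :=
  (volume.restrict Ω).withDensity (fun x => ENNReal.ofReal (bdist Ω x ^ γ))

/-- The weighted Lebesgue space `L¹(Ω; δ^γ)`, with norm `‖f‖ = ∫_Ω |f| δ^γ dx`. -/
abbrev WL1 (Ω : Set (E n)) (γ : ℝ) : Type := Lp ℝ 1 (weightedMeasure Ω γ)

/-- The reference kernel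
`|x-y|^{-(n-2s)} (δ^γ(x)/|x-y|^γ ∧ 1) (δ^γ(y)/|x-y|^γ ∧ 1)`. -/
def refKernel (Ω : Set (E n)) (s γ : ℝ) (x y : E n) : ℝ :=
  1 / ‖x - y‖ ^ ((n : ℝ) - 2 * s) *
    min (bdist Ω x ^ γ / ‖x - y‖ ^ γ) 1 * min (bdist Ω y ^ γ / ‖x - y‖ ^ γ) 1

/-- Green's operator `𝔾₀(f)(x) = ∫_Ω 𝒢₀(x,y) f(y) dy` with kernel `𝒢₀ = G`. -/
def greenOp (Ω : Set (E n)) (G : E n → E n → ℝ) (f : E n → ℝ) (x : E n) : ℝ :=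
  ∫ y in Ω, G x y * f y

/-- The integral defining `𝔾₀(f)(x)` converges absolutely for almost every `x ∈ Ω`. -/
def GreenDefined (Ω : Set (E n)) (G : E n → E n → ℝ) (f : E n → ℝ) : Prop :=
  ∀ᵐ x ∂(volume.restrict Ω), Integrable (fun y => G x y * f y) (volume.restrict Ω)

/-- `G` is the Green's function of the operator `L` on `L²(Ω)`: the Green's operator with
kernel `G` is a two-sided inverse of `L : dom L → L²(Ω)`. -/
structure IsGreenFunction (Ω : Set (E n)) (L : L2 Ω →ₗ.[ℝ] L2 Ω)
    (G : E n → E n → ℝ) : Prop where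
  defined : ∀ f : L2 Ω, GreenDefined Ω G f
  right_inv : ∀ f : L2 Ω, ∃ u : L.domain,
    ((u : L2 Ω) : E n → ℝ) =ᵐ[volume.restrict Ω] greenOp Ω G f ∧ L u = f
  left_inv : ∀ u : L.domain,
    ((u : L2 Ω) : E n → ℝ) =ᵐ[volume.restrict Ω] greenOp Ω G (L u : L2 Ω)

/-- `L` is non-negative on `L²(Ω)` and has a (measurable) symmetric positive Green's function
`G`, defined off the diagonal, which is comparable to the reference kernel. -/
structure K1 (Ω : Set (E n)) (s γ : ℝ) (L : L2 Ω →ₗ.[ℝ] L2 Ω)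
    (G : E n → E n → ℝ) : Prop where
  nonneg : ∀ u : L.domain, 0 ≤ inner ℝ (L u) (u : L2 Ω)
  measurable : AEStronglyMeasurable (fun p : E n × E n => G p.1 p.2)
    ((volume.restrict Ω).prod (volume.restrict Ω))
  green : IsGreenFunction Ω L G
  pos : ∀ x ∈ Ω, ∀ y ∈ Ω, x ≠ y → 0 < G x y
  symm : ∀ x ∈ Ω, ∀ y ∈ Ω, x ≠ y → G x y = G y x
  comparable : ∃ C : ℝ, 0 < C ∧ ∀ x ∈ Ω, ∀ y ∈ Ω, x ≠ y →
    C⁻¹ * refKernel Ω s γ x y ≤ G x y ∧ G x y ≤ C * refKernel Ω s γ x y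

/-- `(φ_j)` is an orthonormal basis of `L²(Ω)` of eigenfunctions of `L` with eigenvalues
`0 < lam 0 ≤ lam 1 ≤ ⋯ ↗ +∞`, repeated according to multiplicity. -/
structure IsEigenbasis {Ω : Set (E n)} (L : L2 Ω →ₗ.[ℝ] L2 Ω) (lam : ℕ → ℝ)
    (φ : HilbertBasis ℕ ℝ (L2 Ω)) : Prop where
  pos : ∀ j, 0 < lam j
  mono : Monotone lam
  tendsto : Tendsto lam atTop atTop
  eigen : ∀ j, ∃ h : φ j ∈ L.domain, L ⟨φ j, h⟩ = lam j • φ j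

/-- The `j`-th term of the series for `𝔾_μ(g)`. -/
def resolventTerm {Ω : Set (E n)} (lam : ℕ → ℝ) (φ : HilbertBasis ℕ ℝ (L2 Ω)) (μ : ℝ)
    (g : L2 Ω) (j : ℕ) : L2 Ω :=
  (inner ℝ g (φ j) / (lam j - μ)) • φ j

/-- `𝔾_μ(g) = ∑_j ⟨g, φ_j⟩ / (λ_j - μ) φ_j` on `L²(Ω)`. -/
def resolventL2 {Ω : Set (E n)} (lam : ℕ → ℝ) (φ : HilbertBasis ℕ ℝ (L2 Ω)) (μ : ℝ)
    (g : L2 Ω) : L2 Ω :=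
  ∑' j, resolventTerm lam φ μ g j

/-- The bounded operator `T` on `L¹(Ω; δ^γ)` extends `𝔾_μ` from `L²(Ω)`. -/
def IsResolventExtension {Ω : Set (E n)} {γ : ℝ} (lam : ℕ → ℝ)
    (φ : HilbertBasis ℕ ℝ (L2 Ω)) (μ : ℝ) (T : WL1 Ω γ →L[ℝ] WL1 Ω γ) : Prop :=
  ∀ (g : L2 Ω) (g' : WL1 Ω γ), (g' : E n → ℝ) =ᵐ[volume.restrict Ω] g →
    (T g' : E n → ℝ) =ᵐ[volume.restrict Ω] resolventL2 lam φ μ g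

/-- `δ^γ L^∞(Ω)`; since `Ω` is bounded, it is a subspace of `L²(Ω)`. -/
def weightedLinfty (Ω : Set (E n)) (γ : ℝ) : Set (L2 Ω) :=
  {ψ | ∃ C : ℝ, ∀ᵐ x ∂(volume.restrict Ω), |ψ x| ≤ C * bdist Ω x ^ γ}

/-- `L_c^∞(Ω)`: bounded measurable functions vanishing (a.e.) outside a compact subset
of `Ω`. -/
structure MemLinftyC (Ω : Set (E n)) (ψ : E n → ℝ) : Prop where
  meas : AEStronglyMeasurable ψ (volume.restrict Ω)
  bounded : ∃ C : ℝ, ∀ᵐ x ∂(volume.restrict Ω), |ψ x| ≤ C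
  support : ∃ K : Set (E n), IsCompact K ∧ K ⊆ Ω ∧
    ∀ᵐ x ∂(volume.restrict Ω), x ∉ K → ψ x = 0

/-- `C_c^∞(Ω)`. -/
structure MemSmoothC (Ω : Set (E n)) (ψ : E n → ℝ) : Prop where
  smooth : ContDiff ℝ ∞ ψ
  compact : HasCompactSupport ψ
  support : tsupport ψ ⊆ Ω

/-- `u` is a `𝔾_μ`-Green solution: `u = 𝔾_μ(f)` a.e. in `Ω`, where `T` is `𝔾_μ` on
`L¹(Ω; δ^γ)`. -/
def IsResolventGreenSol {Ω : Set (E n)} {γ : ℝ} (T : WL1 Ω γ →L[ℝ] WL1 Ω γ)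
    (f u : WL1 Ω γ) : Prop :=
  (u : E n → ℝ) =ᵐ[volume.restrict Ω] T f

/-- `u` is a `𝔾_μ(δ^γ L^∞(Ω))`-weak solution: for every `ψ ∈ δ^γ L^∞(Ω)`,
`∫ u ψ = ∫ f 𝔾_μ(ψ)`, both integrals being absolutely convergent. -/
def IsResolventWeakSol {Ω : Set (E n)} {γ : ℝ} (lam : ℕ → ℝ) (φ : HilbertBasis ℕ ℝ (L2 Ω))
    (μ : ℝ) (f u : WL1 Ω γ) : Prop :=
  ∀ ψ ∈ weightedLinfty Ω γ,
    IntegrableOn (fun x => u x * ψ x) Ω ∧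
    IntegrableOn (fun x => f x * resolventL2 lam φ μ ψ x) Ω ∧
    ∫ x in Ω, u x * ψ x = ∫ x in Ω, f x * resolventL2 lam φ μ ψ x

/-- `u` is a `𝔾₀(𝒯)`-weak solution for the class `𝒯` of functions: for every `ψ` in the class,
`∫ u (ψ - μ 𝔾₀(ψ)) = ∫ f 𝔾₀(ψ)`, both integrals being absolutely convergent. -/
def IsGreenWeakSol {Ω : Set (E n)} {γ : ℝ} (G : E n → E n → ℝ) (𝒯 : (E n → ℝ) → Prop)
    (μ : ℝ) (f u : WL1 Ω γ) : Prop :=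
  ∀ ψ : E n → ℝ, 𝒯 ψ →
    IntegrableOn (fun x => u x * (ψ x - μ * greenOp Ω G ψ x)) Ω ∧
    IntegrableOn (fun x => f x * greenOp Ω G ψ x) Ω ∧
    ∫ x in Ω, u x * (ψ x - μ * greenOp Ω G ψ x) = ∫ x in Ω, f x * greenOp Ω G ψ x

/-- `u` is a `𝔾₀`-Green solution: `u = μ 𝔾₀(u) + 𝔾₀(f)` a.e. in `Ω`. -/
def IsGreenSol {Ω : Set (E n)} {γ : ℝ} (G : E n → E n → ℝ) (μ : ℝ) (f u : WL1 Ω γ) : Prop :=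
  GreenDefined Ω G u ∧ GreenDefined Ω G f ∧
  ∀ᵐ x ∂(volume.restrict Ω), u x = μ * greenOp Ω G u x + greenOp Ω G f x

/-- `v ∈ ℍ²_L(Ω)`: `v ∈ L²(Ω)` and `∑_j λ_j² ⟨v, φ_j⟩² < ∞`. -/
def MemH2 {Ω : Set (E n)} (lam : ℕ → ℝ) (φ : HilbertBasis ℕ ℝ (L2 Ω)) (v : E n → ℝ) : Prop :=
  MemLp v 2 (volume.restrict Ω) ∧
    Summable (fun j => lam j ^ 2 * (∫ x in Ω, v x * φ j x) ^ 2)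

/-- `u` is a spectral solution: `(λ_j - μ) ∫ u φ_j = ∫ f φ_j` for all `j`. -/
def IsSpectralSol {Ω : Set (E n)} (lam : ℕ → ℝ) (φ : HilbertBasis ℕ ℝ (L2 Ω)) (μ : ℝ)
    (f u : E n → ℝ) : Prop :=
  ∀ j, (lam j - μ) * ∫ x in Ω, u x * φ j x = ∫ x in Ω, f x * φ j x

end

end GreenNotions

/-!
On the bounded set `Ω` the kernel `k` is at most the Riesz kernel `|x - y|^(2s - n)`, so the Green's
function splits into a part close to the diagonal, of arbitrarily small norm on `L²(Ω)` and on
`L¹(Ω; δ^γ)` by Schur's test, and a bounded part away from it, which maps `L¹(Ω; δ^γ)` to `L²(Ω)`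
because the kernel is at most a constant times `δ(y)^γ` there. Hence `𝔾₀` is a compact symmetric
operator on `L²(Ω)`, and the spectral theorem gives the eigenbasis. With a Neumann series for the
small part, the same splitting transports the resolvent `𝔾_μ` from `L²(Ω)` to an operator `T` on
`L¹(Ω; δ^γ)` which is the resolvent of the extension of `𝔾₀`. By density, `𝔾₀` and `𝔾_μ` are
self-adjoint for the pairing of `L¹(Ω; δ^γ)` with `δ^γ L^∞(Ω)`, and each of the test classes
separates the points of `L¹(Ω; δ^γ)`, so that every notion of solution says that `u = T f`.
-/

namespace GreenNotions

/-! ## Compact operators and eigenbases -/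

section Enumeration

theorem nonempty_nat_orderIso_of_finite_Iic {ι : Type*} [LinearOrder ι] [Infinite ι]
    (h : ∀ i : ι, (Iic i).Finite) : Nonempty (ℕ ≃o ι) := by
  let _ : LocallyFiniteOrder ι :=
    LocallyFiniteOrder.ofFiniteIcc fun _ b => (h b).subset Icc_subset_Iic_self
  have : NoMaxOrder ι := ⟨fun a => by
    by_contra! ha
    exact infinite_univ ((h a).subset fun x _ => ha x)⟩
  obtain ⟨b, hb⟩ : ∃ b : ι, ∀ a, b ≤ a := by
    obtain ⟨i⟩ := (inferInstance : Nonempty ι)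
    obtain ⟨b, hbi, hb⟩ := (h i).exists_minimal nonempty_Iic
    exact ⟨b, fun a => (le_total b a).elim id fun hab => hb (hab.trans hbi) hab⟩
  let _ : OrderBot ι := { bot := b, bot_le := hb }
  let _ : SuccOrder ι := LinearLocallyFiniteOrder.succOrder ι
  let _ : PredOrder ι := LinearLocallyFiniteOrder.predOrder ι
  exact ⟨orderIsoNatOfLinearSuccPredArch.symm⟩

theorem exists_nat_equiv_monotone {ι : Type*} [Infinite ι] (f : ι → ℝ)
    (hf : ∀ c, {i | f i ≤ c}.Finite) : ∃ e : ℕ ≃ ι, Monotone (f ∘ e) := by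
  have : Countable ι := by
    have hcover : (univ : Set ι) = ⋃ k : ℕ, {i | f i ≤ k} := by
      ext i
      simpa using exists_nat_ge (f i)
    rw [← Set.countable_univ_iff, hcover]
    exact countable_iUnion fun k => (hf k).countable
  obtain ⟨enc, henc⟩ := exists_injective_nat ι
  -- Ties between equal values of `f` are broken by an arbitrary enumeration.
  let key : ι → ℝ ×ₗ ℕ := fun i => toLex (f i, enc i)
  have hkey : Function.Injective key := fun i j hij =>
    henc (Prod.ext_iff.1 (toLex.injective hij)).2
  let _ : LinearOrder ι := LinearOrder.lift' key hkey
  have hmono : Monotone f := fun i j hij => by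
    rcases Prod.Lex.le_iff.1 (show key i ≤ key j from hij) with hlt | heq
    exacts [le_of_lt hlt, le_of_eq heq.1]
  obtain ⟨e⟩ := nonempty_nat_orderIso_of_finite_Iic fun i : ι =>
    (hf (f i)).subset fun j hj => hmono hj
  exact ⟨e.toEquiv, hmono.comp e.monotone⟩

end Enumeration

section CompactOperators

variable {H F : Type*} [NormedAddCommGroup H] [InnerProductSpace ℝ H]
  [NormedAddCommGroup F] [NormedSpace ℝ F] {ι : Type*}

theorem norm_sq_sum_innerSL_smulRight_le {e : ι → H} (he : Orthonormal ℝ e) (w : ι → F)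
    (S : Finset ι) :
    ‖∑ i ∈ S, (innerSL ℝ (e i)).smulRight (w i)‖ ^ 2 ≤ ∑ i ∈ S, ‖w i‖ ^ 2 := by
  have hnn : 0 ≤ ∑ i ∈ S, ‖w i‖ ^ 2 := by positivity
  refine (Real.le_sqrt (norm_nonneg _) hnn).1
    (ContinuousLinearMap.opNorm_le_bound _ (Real.sqrt_nonneg _) fun x => ?_)
  calc ‖(∑ i ∈ S, (innerSL ℝ (e i)).smulRight (w i)) x‖
      ≤ ∑ i ∈ S, ‖w i‖ * ‖inner ℝ (e i) x‖ := by
        rw [sum_apply]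
        refine norm_sum_le_of_le _ fun i _ => ?_
        simp [norm_smul, mul_comm]
    _ ≤ √(∑ i ∈ S, ‖w i‖ ^ 2) * √(∑ i ∈ S, ‖inner ℝ (e i) x‖ ^ 2) :=
        Real.sum_mul_le_sqrt_mul_sqrt ..
    _ ≤ √(∑ i ∈ S, ‖w i‖ ^ 2) * ‖x‖ := by
        gcongr
        exact (Real.sqrt_le_left (norm_nonneg x)).2 (he.sum_inner_products_le x)

theorem isCompactOperator_of_sum_norm_sq_le [CompleteSpace F] (e : HilbertBasis ι ℝ H)
    (B : H →L[ℝ] F) (M : ℝ) (hM : ∀ S : Finset ι, ∑ i ∈ S, ‖B (e i)‖ ^ 2 ≤ M) :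
    IsCompactOperator B := by
  let r : ι → (H →L[ℝ] F) := fun i => (innerSL ℝ (e i)).smulRight (B (e i))
  have hsummable : Summable r := by
    rw [summable_iff_vanishing_norm]
    intro ε hε
    have hsq : Summable fun i => ‖B (e i)‖ ^ 2 := summable_of_sum_le (fun i => by positivity) hM
    obtain ⟨S, hS⟩ := summable_iff_vanishing_norm.1 hsq (ε ^ 2) (by positivity)
    refine ⟨S, fun t ht => lt_of_pow_lt_pow_left₀ 2 hε.le ?_⟩
    exact (norm_sq_sum_innerSL_smulRight_le e.orthonormal _ t).trans_lt
      ((le_abs_self _).trans_lt (hS t ht))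
  have hsum : ∑' i, r i = B := by
    ext x
    refine (hsummable.hasSum.mapL (ContinuousLinearMap.apply ℝ F x)).unique ?_
    simpa [r, e.repr_apply_apply] using (e.hasSum_repr x).mapL B
  have hrank : ∀ i, IsCompactOperator (r i) := fun i =>
    (isCompactOperator_of_locallyCompactSpace_rng
      (ContinuousLinearMap.toSpanSingleton ℝ (B (e i)))).comp_clm (innerSL ℝ (e i))
  exact isCompactOperator_of_tendsto (hsum ▸ hsummable.hasSum) <| Eventually.of_forall fun S =>
    Submodule.sum_mem (compactOperator (RingHom.id ℝ) H F) fun i _ => hrank i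

theorem finite_setOf_le_eigenvalue_of_isCompactOperator {A : H →L[ℝ] H}
    (hA : IsCompactOperator A) {v : ι → H} (hv : Orthonormal ℝ v) {a : ι → ℝ}
    (hav : ∀ i, A (v i) = a i • v i) {ε : ℝ} (hε : 0 < ε) : {i | ε ≤ a i}.Finite := by
  by_contra hinf
  let f := Set.Infinite.natEmbedding _ hinf
  have hsep : ∀ k l, k ≠ l → ε ≤ ‖A (v (f k)) - A (v (f l))‖ := fun k l hkl => by
    have hne : (f k : ι) ≠ f l := fun h => hkl (f.injective (Subtype.ext h))
    have hk : ε ≤ a (f k) := (f k).2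
    refine (sq_le_sq₀ hε.le (norm_nonneg _)).1 ?_
    calc ε ^ 2 ≤ a (f k) ^ 2 + a (f l) ^ 2 := by nlinarith [sq_nonneg (a (f l))]
      _ = ‖A (v (f k)) - A (v (f l))‖ ^ 2 := by
        rw [hav, hav, norm_sub_sq_real]
        simp [norm_smul, hv.1, inner_smul_left, inner_smul_right, hv.2 hne]
  have hmem : ∀ k, A (v (f k)) ∈ closure (A '' Metric.closedBall 0 1) := fun k =>
    subset_closure ⟨_, by simp [hv.1], rfl⟩
  obtain ⟨x, -, σ, hσ, hx⟩ := (hA.isCompact_closure_image_closedBall 1).tendsto_subseq hmem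
  obtain ⟨N, hN⟩ := Metric.cauchySeq_iff.1 hx.cauchySeq ε hε
  have hclose := hN N le_rfl (N + 1) N.le_succ
  rw [Function.comp_apply, Function.comp_apply, dist_eq_norm] at hclose
  exact hclose.not_ge (hsep _ _ (hσ N.lt_succ_self).ne)

end CompactOperators

section Eigenbasis

variable {H : Type*} [NormedAddCommGroup H] [InnerProductSpace ℝ H]

theorem exists_diagonal_clm {ι : Type*} (φ : HilbertBasis ι ℝ H) {c : ι → ℝ} {M : ℝ}
    (hM : 0 ≤ M) (hc : ∀ j, |c j| ≤ M) :
    ∃ Γ : H →L[ℝ] H, ∀ g, HasSum (fun j => (c j * inner ℝ g (φ j)) • φ j) (Γ g) := by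
  let D := lp.mapCLM (𝕜 := ℝ) 2 (fun j => c j • ContinuousLinearMap.id ℝ ℝ) hM
    (fun j => by simpa [norm_smul] using hc j)
  refine ⟨φ.repr.symm.toContinuousLinearEquiv.toContinuousLinearMap ∘L D ∘L
    φ.repr.toContinuousLinearEquiv.toContinuousLinearMap, fun g => ?_⟩
  simpa [D, φ.repr_apply_apply, real_inner_comm] using φ.hasSum_repr_symm (D (φ.repr g))

theorem clm_ext_hilbertBasis {ι F : Type*} [NormedAddCommGroup F] [NormedSpace ℝ F]
    (φ : HilbertBasis ι ℝ H) {S T : H →L[ℝ] F} (h : ∀ j, S (φ j) = T (φ j)) : S = T :=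
  ContinuousLinearMap.ext_on (Submodule.dense_iff_topologicalClosure_eq_top.2 φ.dense_span)
    (forall_mem_range.2 h)

variable [CompleteSpace H]

theorem exists_hilbertBasis_eigenvectors {A : H →L[ℝ] H} (hA : IsCompactOperator A)
    (hsymm : A.IsSymmetric) (hinj : Function.Injective A) :
    ∃ (ι : Type) (a : ι → ℝ) (φ : HilbertBasis ι ℝ H), ∀ i, A (φ i) = a i • φ i := by
  let T : Module.End ℝ H := A
  have hfd : ∀ a : T.Eigenvalues, FiniteDimensional ℝ (T.eigenspace a) := fun a => by
    refine ContinuousLinearMap.finite_dimensional_eigenspace hA a fun h0 => ?_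
    obtain ⟨v, hv, hv0⟩ := Module.End.HasEigenvalue.exists_hasEigenvector a.2
    rw [Module.End.mem_eigenspace_iff] at hv
    refine hv0 (hinj ?_)
    rw [map_zero]
    exact hv.trans ((congrArg (· • v) h0).trans (zero_smul ℝ v))
  let b (a : T.Eigenvalues) : OrthonormalBasis _ ℝ (T.eigenspace a) := stdOrthonormalBasis ℝ _
  let v : (Σ a : T.Eigenvalues, Fin (Module.finrank ℝ (T.eigenspace a))) → H :=
    fun i => b i.1 i.2
  have hv : Orthonormal ℝ v :=
    hsymm.orthogonalFamily_eigenspaces'.orthonormal_sigma_orthonormal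
      (v_family := fun a => b a) fun a => (b a).orthonormal
  have hspan : (Submodule.span ℝ (range v))ᗮ = ⊥ := by
    rw [eq_bot_iff, ← ContinuousLinearMap.orthogonalComplement_iSup_eigenspaces_eq_bot hA hsymm]
    refine Submodule.orthogonal_le (iSup_le fun a x hx => ?_)
    obtain rfl | hx0 := eq_or_ne x 0
    · exact zero_mem _
    let a' : T.Eigenvalues := ⟨a, Module.End.hasEigenvalue_of_hasEigenvector ⟨hx, hx0⟩⟩
    have hrepr := congrArg Subtype.val ((b a').sum_repr ⟨x, hx⟩)
    rw [Submodule.coe_sum] at hrepr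
    rw [← show _ = x from hrepr]
    exact Submodule.sum_mem _ fun i _ =>
      Submodule.smul_mem _ _ (Submodule.subset_span ⟨⟨a', i⟩, rfl⟩)
  refine ⟨_, fun i => i.1, HilbertBasis.mkOfOrthogonalEqBot hv hspan, fun i => ?_⟩
  rw [HilbertBasis.coe_mkOfOrthogonalEqBot]
  exact Module.End.mem_eigenspace_iff.1 (b i.1 i.2).2

theorem exists_nat_hilbertBasis_eigenvectors (hH : ¬ FiniteDimensional ℝ H) {A : H →L[ℝ] H}
    (hA : IsCompactOperator A) (hsymm : A.IsSymmetric) (hinj : Function.Injective A)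
    (hpos : ∀ v, 0 ≤ inner ℝ v (A v)) :
    ∃ (lam : ℕ → ℝ) (φ : HilbertBasis ℕ ℝ H), (∀ j, 0 < lam j) ∧ Monotone lam ∧
      Tendsto lam atTop atTop ∧ ∀ j, A (φ j) = (lam j)⁻¹ • φ j := by
  obtain ⟨ι, a, φ, hφ⟩ := exists_hilbertBasis_eigenvectors hA hsymm hinj
  have ha : ∀ i, 0 < a i := fun i => by
    have hnn := hpos (φ i)
    rw [hφ, inner_smul_right, real_inner_self_eq_norm_sq, φ.orthonormal.1, one_pow, mul_one] at hnn
    refine hnn.lt_of_ne' fun h0 => φ.orthonormal.ne_zero i (hinj ?_)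
    rw [hφ, h0, zero_smul, map_zero]
  have : Infinite ι := by
    by_contra hfin
    have := not_infinite_iff_finite.1 hfin
    have := Fintype.ofFinite ι
    exact hH (Module.Finite.of_basis φ.toOrthonormalBasis.toBasis)
  have hfin : ∀ c, {i | (a i)⁻¹ ≤ c}.Finite := fun c => by
    refine (finite_setOf_le_eigenvalue_of_isCompactOperator hA φ.orthonormal hφ
      (ε := (max c 1)⁻¹) (by positivity)).subset fun i (hi : (a i)⁻¹ ≤ c) => ?_
    exact inv_le_of_inv_le₀ (ha i) (hi.trans (le_max_left c 1))
  obtain ⟨e, he⟩ := exists_nat_equiv_monotone (fun i => (a i)⁻¹) hfin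
  have hspan : (Submodule.span ℝ (range (φ ∘ e)))ᗮ = ⊥ := by
    rw [e.surjective.range_comp, ← Submodule.orthogonal_closure, φ.dense_span,
      Submodule.top_orthogonal_eq_bot]
  refine ⟨_, HilbertBasis.mkOfOrthogonalEqBot (φ.orthonormal.comp e e.injective) hspan,
    fun j => inv_pos.2 (ha (e j)), he, ?_, fun j => ?_⟩
  · refine tendsto_atTop_atTop_of_monotone he fun c => ?_
    by_contra! hc
    exact infinite_univ (((hfin c).preimage e.injective.injOn).subset fun j _ => (hc j).le)
  · rw [HilbertBasis.coe_mkOfOrthogonalEqBot]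
    simp [hφ]

theorem exists_pos_forall_le_abs_sub {lam : ℕ → ℝ} (hlam : Tendsto lam atTop atTop) {μ : ℝ}
    (hμ : μ ∉ range lam) : ∃ d > 0, ∀ j, d ≤ |lam j - μ| := by
  have hdist : Tendsto (fun j => |lam j - μ|) cofinite atTop := by
    rw [Nat.cofinite_eq_atTop]
    exact tendsto_abs_atTop_atTop.comp (tendsto_atTop_add_const_right _ (-μ) hlam)
  obtain ⟨j₀, hj₀⟩ := hdist.exists_forall_le
  exact ⟨_, abs_pos.2 (sub_ne_zero.2 fun h => hμ ⟨j₀, h⟩), hj₀⟩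

end Eigenbasis

/-! ## Resolvents and smoothing pairs -/

section Resolvent

variable {X Y : Type*} [NormedAddCommGroup X] [NormedSpace ℝ X]
  [NormedAddCommGroup Y] [NormedSpace ℝ Y]

/-- `Γ = A (1 - μ A)⁻¹`. When `A` is the inverse of an unbounded operator `L`, this says that `Γ`
is the inverse of `L - μ`. -/
structure IsResolventAt (A Γ : X →L[ℝ] X) (μ : ℝ) : Prop where
  left : Γ - μ • (Γ ∘L A) = A
  right : Γ - μ • (A ∘L Γ) = A

theorem IsResolventAt.eq_apply_iff {A Γ : X →L[ℝ] X} {μ : ℝ} (h : IsResolventAt A Γ μ) {f u : X} :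
    u = Γ f ↔ u = μ • A u + A f := by
  have hleft (x : X) : Γ x - μ • Γ (A x) = A x := DFunLike.congr_fun h.left x
  have hright (x : X) : Γ x - μ • A (Γ x) = A x := DFunLike.congr_fun h.right x
  constructor
  · rintro rfl
    rw [← hright f, add_sub_cancel]
  · intro hu
    have hA : A f = u - μ • A u := eq_sub_of_add_eq' hu.symm
    have hfix : Γ f = A f + μ • Γ (A f) := sub_eq_iff_eq_add.1 (hleft f)
    rw [hfix, hA, map_sub, map_smul, hleft, sub_add_cancel]

theorem IsResolventAt.of_denseRange {j : X →L[ℝ] Y} (hj : DenseRange j) {A Γ : X →L[ℝ] X}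
    {A' T : Y →L[ℝ] Y} {μ : ℝ} (h : IsResolventAt A Γ μ) (hA : A' ∘L j = j ∘L A)
    (hT : T ∘L j = j ∘L Γ) : IsResolventAt A' T μ := by
  have hA (x : X) : A' (j x) = j (A x) := DFunLike.congr_fun hA x
  have hT (x : X) : T (j x) = j (Γ x) := DFunLike.congr_fun hT x
  refine ⟨?_, ?_⟩ <;> refine ContinuousLinearMap.coeFn_injective
    (hj.equalizer (map_continuous _) (map_continuous _) (funext fun x => ?_))
  · calc T (j x) - μ • T (A' (j x)) = j ((Γ - μ • (Γ ∘L A)) x) := by simp [hA, hT]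
      _ = A' (j x) := by rw [h.left, hA]
  · calc T (j x) - μ • A' (T (j x)) = j ((Γ - μ • (A ∘L Γ)) x) := by simp [hA, hT]
      _ = A' (j x) := by rw [h.right, hA]

theorem exists_inverse_one_sub [CompleteSpace X] {R : X →L[ℝ] X} (hR : ‖R‖ < 1) :
    ∃ N : X →L[ℝ] X, (∀ x, N (x - R x) = x) ∧ ∀ x, N x - R (N x) = x :=
  ⟨↑(Units.oneSub R hR)⁻¹, DFunLike.congr_fun (Units.oneSub R hR).inv_mul,
    DFunLike.congr_fun (Units.oneSub R hR).mul_inv⟩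

/-- The operators `A` on `X` and `A'` on `Y`, related by the inclusion `j : X → Y`, differ from
intertwined operators of arbitrarily small norm by an operator `B : Y → X` which is compact on
`X`. This is what allows the resolvents of `A` to be carried over to `Y`. -/
def IsSmoothingPair (j : X →L[ℝ] Y) (A : X →L[ℝ] X) (A' : Y →L[ℝ] Y) : Prop :=
  ∀ η > 0, ∃ (R : X →L[ℝ] X) (R' : Y →L[ℝ] Y) (B : Y →L[ℝ] X), ‖R‖ ≤ η ∧ ‖R'‖ ≤ η ∧
    A = R + B ∘L j ∧ A' = R' + j ∘L B ∧ j ∘L R = R' ∘L j ∧ IsCompactOperator (B ∘L j)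

namespace IsSmoothingPair

variable {j : X →L[ℝ] Y} {A : X →L[ℝ] X} {A' : Y →L[ℝ] Y}

theorem intertwines (h : IsSmoothingPair j A A') : A' ∘L j = j ∘L A := by
  obtain ⟨R, R', B, -, -, rfl, rfl, hR, -⟩ := h 1 one_pos
  rw [ContinuousLinearMap.add_comp, ContinuousLinearMap.comp_add, hR,
    ContinuousLinearMap.comp_assoc]

theorem isCompactOperator [CompleteSpace X] (h : IsSmoothingPair j A A') : IsCompactOperator A := by
  choose R _ B hR _ hA _ _ hB using fun k : ℕ => h (1 / ((k : ℝ) + 1)) Nat.one_div_pos_of_nat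
  have hlim : Tendsto (fun k => B k ∘L j) atTop (𝓝 A) := by
    rw [tendsto_iff_norm_sub_tendsto_zero]
    refine squeeze_zero (fun k => norm_nonneg _) (fun k => ?_)
      tendsto_one_div_add_atTop_nhds_zero_nat
    rw [hA k, sub_add_cancel_right, norm_neg]
    exact hR k
  exact isCompactOperator_of_tendsto hlim (Eventually.of_forall hB)

/- With `N = (1 - μ R)⁻¹` and `N' = (1 - μ R')⁻¹`, the operator `S = 1 + μ Γ = (1 - μ A)⁻¹`
satisfies `S = N + μ S B j N`. So `N' + μ j S B N'` is a candidate for `(1 - μ A')⁻¹`. -/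
theorem exists_extension [CompleteSpace X] [CompleteSpace Y] (h : IsSmoothingPair j A A')
    {Γ : X →L[ℝ] X} {μ : ℝ} (hΓ : IsResolventAt A Γ μ) : ∃ T : Y →L[ℝ] Y, T ∘L j = j ∘L Γ := by
  obtain ⟨R, R', B, hR, hR', hA, -, hjR, -⟩ := h (|μ| + 1)⁻¹ (by positivity)
  have hsmall {c : ℝ} (hc : c ≤ (|μ| + 1)⁻¹) : |μ| * c < 1 := by
    calc |μ| * c ≤ |μ| * (|μ| + 1)⁻¹ := by gcongr
      _ < 1 := by rw [← div_eq_mul_inv, div_lt_one (by positivity)]; exact lt_add_one _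
  obtain ⟨N, -, hN⟩ := exists_inverse_one_sub (R := μ • R) (by rw [norm_smul]; exact hsmall hR)
  obtain ⟨N', hN', -⟩ := exists_inverse_one_sub (R := μ • R') (by rw [norm_smul]; exact hsmall hR')
  have hNj (x : X) : N' (j x) = j (N x) := by
    have hjR (y : X) : j (R y) = R' (j y) := DFunLike.congr_fun hjR y
    rw [← hN' (j (N x)), smul_apply, ← hjR, ← map_smul, ← map_sub, ← smul_apply, hN]
  let S : X →L[ℝ] X := 1 + μ • Γ
  have hSA (x : X) : S (x - μ • A x) = x := by
    have hΓA : Γ x - μ • Γ (A x) = A x := DFunLike.congr_fun hΓ.left x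
    calc S (x - μ • A x) = x - μ • A x + μ • (Γ x - μ • Γ (A x)) := by simp [S]
      _ = x := by rw [hΓA, sub_add_cancel]
  have hAS (x : X) : A (S x) = Γ x := by
    have hAΓ : Γ x - μ • A (Γ x) = A x := DFunLike.congr_fun hΓ.right x
    calc A (S x) = A x + μ • A (Γ x) := by simp [S]
      _ = Γ x := by rw [← hAΓ, sub_add_cancel]
  have hSN (x : X) : S x = N x + μ • S (B (j (N x))) := by
    have hres : N x - μ • A (N x) = x - μ • B (j (N x)) := by
      nth_rewrite 3 [← hN x]
      simp only [hA, add_apply, ContinuousLinearMap.comp_apply, smul_apply]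
      module
    have := hSA (N x)
    rw [hres, map_sub, map_smul] at this
    exact sub_eq_iff_eq_add.1 this
  refine ⟨A' ∘L (N' + μ • (j ∘L S ∘L B ∘L N')), ContinuousLinearMap.ext fun x => ?_⟩
  calc A' (N' (j x) + μ • j (S (B (N' (j x))))) = A' (j (S x)) := by
        rw [hNj, ← map_smul, ← map_add, ← hSN x]
    _ = j (Γ x) := by rw [← hAS]; exact DFunLike.congr_fun h.intertwines (S x)

end IsSmoothingPair

end Resolvent

/-! ## Integral operators -/

section Kernel

variable {α : Type*} [MeasurableSpace α] {ν ρ σ : Measure α} {p q : ℝ≥0∞} {K : α → α → ℝ}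

theorem exists_clm_of_eLpNorm_le [Fact (1 ≤ p)] [Fact (1 ≤ q)] (S : Lp ℝ p ρ → α → ℝ)
    (hmeas : ∀ f, AEStronglyMeasurable (S f) σ) (hadd : ∀ f g, S (f + g) =ᵐ[σ] S f + S g)
    (hsmul : ∀ (c : ℝ) f, S (c • f) =ᵐ[σ] c • S f) {M : ℝ≥0∞} (hM : M ≠ ⊤)
    (hle : ∀ f, eLpNorm (S f) q σ ≤ M * eLpNorm f p ρ) :
    ∃ T : Lp ℝ p ρ →L[ℝ] Lp ℝ q σ, ‖T‖ ≤ M.toReal ∧ ∀ f, T f =ᵐ[σ] S f := by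
  have hmem (f : Lp ℝ p ρ) : MemLp (S f) q σ :=
    ⟨hmeas f, (hle f).trans_lt (ENNReal.mul_lt_top hM.lt_top (Lp.eLpNorm_lt_top f))⟩
  let T : Lp ℝ p ρ →ₗ[ℝ] Lp ℝ q σ :=
    { toFun := fun f => (hmem f).toLp
      map_add' := fun f g => by
        rw [← MemLp.toLp_add, MemLp.toLp_eq_toLp_iff]
        exact hadd f g
      map_smul' := fun c f => by
        rw [RingHom.id_apply, ← MemLp.toLp_const_smul, MemLp.toLp_eq_toLp_iff]
        exact hsmul c f }
  have hT (f : Lp ℝ p ρ) : ‖T f‖ ≤ M.toReal * ‖f‖ := by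
    rw [show T f = (hmem f).toLp from rfl, Lp.norm_toLp, Lp.norm_def, ← ENNReal.toReal_mul]
    exact ENNReal.toReal_mono (ENNReal.mul_ne_top hM (Lp.eLpNorm_ne_top f)) (hle f)
  exact ⟨T.mkContinuous _ hT, T.mkContinuous_norm_le ENNReal.toReal_nonneg hT,
    fun f => (hmem f).coeFn_toLp⟩

/-- `T` is the integral operator with kernel `K` with respect to `ν`, the defining integrals being
absolutely convergent almost everywhere. The measures `ρ` and `σ` defining the norms may differ
from `ν`. -/
def IsKernelOp [Fact (1 ≤ p)] [Fact (1 ≤ q)] (ν : Measure α) (K : α → α → ℝ)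
    (T : Lp ℝ p ρ →L[ℝ] Lp ℝ q σ) : Prop :=
  ∀ f, (∀ᵐ x ∂ν, Integrable (fun y => K x y * f y) ν) ∧
    T f =ᵐ[ν] fun x => ∫ y, K x y * f y ∂ν

theorem ae_lt_top_of_eLpNorm_lt_top {g : α → ℝ≥0∞} (hg : AEMeasurable g ν) (hq : q ≠ 0)
    (hlt : eLpNorm g q ν < ⊤) : ∀ᵐ x ∂ν, g x < ⊤ := by
  rcases eq_or_ne q ⊤ with rfl | hq'
  · rw [eLpNorm_exponent_top] at hlt
    filter_upwards [enorm_ae_le_eLpNormEssSup g ν] with x hx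
    exact hx.trans_lt hlt
  · have hfin := (eLpNorm_lt_top_iff_lintegral_rpow_enorm_lt_top hq hq').1 hlt
    filter_upwards [ae_lt_top' (hg.enorm.pow_const q.toReal) hfin.ne] with x hx
    exact (ENNReal.rpow_lt_top_iff_of_pos (ENNReal.toReal_pos hq hq')).1 hx

theorem exists_isKernelOp [SFinite ν] [Fact (1 ≤ p)] [Fact (1 ≤ q)]
    (hK : AEStronglyMeasurable (fun z : α × α => K z.1 z.2) (ν.prod ν))
    (hνρ : ν ≪ ρ) (hνσ : ν ≪ σ) (hσν : σ ≪ ν) {M : ℝ≥0∞} (hM : M ≠ ⊤)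
    (hle : ∀ f : α → ℝ, AEStronglyMeasurable f ν →
      eLpNorm (fun x => ∫⁻ y, ‖K x y‖ₑ * ‖f y‖ₑ ∂ν) q σ ≤ M * eLpNorm f p ρ) :
    ∃ T : Lp ℝ p ρ →L[ℝ] Lp ℝ q σ, ‖T‖ ≤ M.toReal ∧ IsKernelOp ν K T := by
  have hq : q ≠ 0 := (zero_lt_one.trans_le (Fact.out : 1 ≤ q)).ne'
  have hf (f : Lp ℝ p ρ) : AEStronglyMeasurable f ν := (Lp.aestronglyMeasurable f).mono_ac hνρ
  have hKf (f : Lp ℝ p ρ) : AEStronglyMeasurable (fun z : α × α => K z.1 z.2 * f z.2)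
    (ν.prod ν) := hK.mul (hf f).comp_snd
  have hint (f : Lp ℝ p ρ) : ∀ᵐ x ∂ν, Integrable (fun y => K x y * f y) ν := by
    have hmeas : AEMeasurable (fun x => ∫⁻ y, ‖K x y‖ₑ * ‖f y‖ₑ ∂ν) ν := by
      simpa only [enorm_mul] using (hKf f).enorm.lintegral_prod_right'
    have hfin := ae_lt_top_of_eLpNorm_lt_top (hmeas.mono_ac hσν) hq
      ((hle f (hf f)).trans_lt (ENNReal.mul_lt_top hM.lt_top (Lp.eLpNorm_lt_top f)))
    filter_upwards [hνσ.ae_le hfin, (hKf f).prodMk_left] with x hx hxm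
    exact ⟨hxm, by simpa only [hasFiniteIntegral_iff_enorm, enorm_mul] using hx⟩
  obtain ⟨T, hTM, hT⟩ := exists_clm_of_eLpNorm_le (σ := σ) (q := q)
    (fun (f : Lp ℝ p ρ) x => ∫ y, K x y * f y ∂ν)
    (fun f => (hKf f).integral_prod_right'.mono_ac hσν)
    (fun f g => by
      filter_upwards [hσν.ae_le (hint f), hσν.ae_le (hint g)] with x hxf hxg
      rw [Pi.add_apply, ← integral_add hxf hxg]
      refine integral_congr_ae ?_
      filter_upwards [hνρ.ae_le (Lp.coeFn_add f g)] with y hy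
      rw [hy, Pi.add_apply, mul_add])
    (fun c f => Eventually.of_forall fun x => by
      rw [Pi.smul_apply, ← integral_smul]
      refine integral_congr_ae ?_
      filter_upwards [hνρ.ae_le (Lp.coeFn_smul c f)] with y hy
      rw [hy, Pi.smul_apply, mul_smul_comm])
    hM
    (fun f => (eLpNorm_mono_enorm fun x => by
      simpa only [enorm_mul, enorm_eq_self] using
        enorm_integral_le_lintegral_enorm fun y => K x y * f y).trans (hle f (hf f)))
  exact ⟨T, hTM, fun f => ⟨hint f, hνσ.ae_le (hT f)⟩⟩

section Algebra

variable [Fact (1 ≤ p)] [Fact (1 ≤ q)] {p' q' : ℝ≥0∞} [Fact (1 ≤ p')] [Fact (1 ≤ q')]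
  {ρ' σ' : Measure α}

theorem IsKernelOp.ext (hσν : σ ≪ ν) {T T' : Lp ℝ p ρ →L[ℝ] Lp ℝ q σ} (hT : IsKernelOp ν K T)
    (hT' : IsKernelOp ν K T') : T = T' := by
  refine ContinuousLinearMap.ext fun f => Lp.ext (hσν.ae_le ?_)
  exact (hT f).2.trans (hT' f).2.symm

theorem IsKernelOp.add (hνσ : ν ≪ σ) {K' : α → α → ℝ} {T T' : Lp ℝ p ρ →L[ℝ] Lp ℝ q σ}
    (hT : IsKernelOp ν K T) (hT' : IsKernelOp ν K' T') : IsKernelOp ν (K + K') (T + T') := by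
  intro f
  simp only [Pi.add_apply, add_mul]
  refine ⟨?_, ?_⟩
  · filter_upwards [(hT f).1, (hT' f).1] with x hx hx' using hx.add hx'
  · filter_upwards [hT f |>.1, (hT f).2, (hT' f).1, (hT' f).2,
      hνσ.ae_le (Lp.coeFn_add (T f) (T' f))] with x hx hTx hx' hTx' hadd
    rw [add_apply, hadd, Pi.add_apply, hTx, hTx', integral_add hx hx']

theorem IsKernelOp.comp {T : Lp ℝ p ρ →L[ℝ] Lp ℝ q σ} (hT : IsKernelOp ν K T)
    {j : Lp ℝ p' ρ' →L[ℝ] Lp ℝ p ρ} (hj : ∀ f, j f =ᵐ[ν] f) : IsKernelOp ν K (T ∘L j) := by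
  intro f
  have hKf (x : α) : (fun y => K x y * j f y) =ᵐ[ν] fun y => K x y * f y := by
    filter_upwards [hj f] with y hy
    rw [hy]
  refine ⟨?_, ?_⟩
  · filter_upwards [(hT (j f)).1] with x hx using hx.congr (hKf x)
  · filter_upwards [(hT (j f)).2] with x hx using hx.trans (integral_congr_ae (hKf x))

theorem IsKernelOp.of_ae_eq {T : Lp ℝ p ρ →L[ℝ] Lp ℝ q σ} (hT : IsKernelOp ν K T)
    {T' : Lp ℝ p ρ →L[ℝ] Lp ℝ q' σ'} (hTT' : ∀ f, T' f =ᵐ[ν] T f) : IsKernelOp ν K T' :=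
  fun f => ⟨(hT f).1, (hTT' f).trans (hT f).2⟩

end Algebra

end Kernel

/-! ## Weighted `L¹` spaces -/

/-- `ρ` is the measure `w ν`, where `w` is positive and bounded almost everywhere. The measure `ρ`
is a parameter so that `Lp ℝ 1 ρ` can be any given presentation of the weighted space. -/
structure IsWeight {α : Type*} [MeasurableSpace α] (ν ρ : Measure α) (w : α → ℝ) : Prop where
  measurable : Measurable w
  pos : ∀ᵐ x ∂ν, 0 < w x
  bounded : ∃ D, ∀ᵐ x ∂ν, w x ≤ D
  eq_withDensity : ρ = ν.withDensity fun x => ENNReal.ofReal (w x)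

/-- `ψ` is measurable and `|ψ| ≤ C w` almost everywhere, for some constant `C`. These functions
form the dual of the weighted space `L¹(w ν)` under the pairing `∫ f ψ dν`. -/
def IsWeightBounded {α : Type*} [MeasurableSpace α] (ν : Measure α) (w ψ : α → ℝ) : Prop :=
  AEStronglyMeasurable ψ ν ∧ ∃ C, ∀ᵐ x ∂ν, |ψ x| ≤ C * w x

section Weight

variable {α : Type*} [MeasurableSpace α] {ν ρ : Measure α} {w ψ : α → ℝ}

namespace IsWeight

theorem absolutelyContinuous (hw : IsWeight ν ρ w) : ρ ≪ ν := by
  rw [hw.eq_withDensity]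
  exact withDensity_absolutelyContinuous _ _

theorem absolutelyContinuous' (hw : IsWeight ν ρ w) : ν ≪ ρ := by
  rw [hw.eq_withDensity]
  refine withDensity_absolutelyContinuous' hw.measurable.ennreal_ofReal.aemeasurable ?_
  filter_upwards [hw.pos] with x hx using (ENNReal.ofReal_pos.2 hx).ne'

theorem ext_iff_ae (hw : IsWeight ν ρ w) {f g : Lp ℝ 1 ρ} : f = g ↔ f =ᵐ[ν] g :=
  ⟨fun h => h ▸ EventuallyEq.rfl, fun h => Lp.ext (hw.absolutelyContinuous.ae_le h)⟩

theorem eLpNorm_one (hw : IsWeight ν ρ w) {f : α → ℝ} (hf : AEStronglyMeasurable f ν) :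
    eLpNorm f 1 ρ = ∫⁻ x, ENNReal.ofReal (w x) * ‖f x‖ₑ ∂ν := by
  rw [eLpNorm_one_eq_lintegral_enorm, hw.eq_withDensity]
  exact lintegral_withDensity_eq_lintegral_mul₀ hw.measurable.ennreal_ofReal.aemeasurable hf.enorm

theorem aestronglyMeasurable (hw : IsWeight ν ρ w) (f : Lp ℝ 1 ρ) : AEStronglyMeasurable f ν :=
  (Lp.aestronglyMeasurable f).mono_ac hw.absolutelyContinuous'

theorem integrable_iff (hw : IsWeight ν ρ w) {f : α → ℝ} :
    Integrable f ρ ↔ Integrable (fun x => w x * f x) ν := by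
  rw [hw.eq_withDensity, integrable_withDensity_iff_integrable_smul₀'
    hw.measurable.ennreal_ofReal.aemeasurable
    (Eventually.of_forall fun x => ENNReal.ofReal_lt_top)]
  refine integrable_congr ?_
  filter_upwards [hw.pos] with x hx
  rw [ENNReal.toReal_ofReal hx.le, smul_eq_mul]

theorem integrable_abs_mul (hw : IsWeight ν ρ w) (f : Lp ℝ 1 ρ) :
    Integrable (fun x => |f x| * w x) ν := by
  simpa only [mul_comm, Real.norm_eq_abs] using hw.integrable_iff.1 (L1.integrable_coeFn f).norm

theorem norm_eq (hw : IsWeight ν ρ w) (f : Lp ℝ 1 ρ) : ‖f‖ = ∫ x, |f x| * w x ∂ν := by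
  rw [L1.norm_eq_integral_norm, integral_eq_lintegral_of_nonneg_ae
    (Eventually.of_forall fun x => norm_nonneg _) (Lp.aestronglyMeasurable f).norm,
    integral_eq_lintegral_of_nonneg_ae]
  · simp only [ofReal_norm]
    rw [← eLpNorm_one_eq_lintegral_enorm, hw.eLpNorm_one (hw.aestronglyMeasurable f)]
    congr 1
    refine lintegral_congr_ae ?_
    filter_upwards with x
    rw [ENNReal.ofReal_mul (abs_nonneg _), ← Real.enorm_eq_ofReal_abs, mul_comm]
  · filter_upwards [hw.pos] with x hx using mul_nonneg (abs_nonneg _) hx.le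
  · exact (hw.integrable_abs_mul f).aestronglyMeasurable

theorem exists_inclusion [IsFiniteMeasure ν] (hw : IsWeight ν ρ w) :
    ∃ j : Lp ℝ 2 ν →L[ℝ] Lp ℝ 1 ρ, ∀ g, j g =ᵐ[ν] g := by
  obtain ⟨D, hD⟩ := hw.bounded
  let M : ℝ≥0∞ := ENNReal.ofReal D *
    ν univ ^ (1 / (1 : ℝ≥0∞).toReal - 1 / (2 : ℝ≥0∞).toReal)
  have hM : M ≠ ⊤ := ENNReal.mul_ne_top ENNReal.ofReal_ne_top
    (ENNReal.rpow_ne_top_of_nonneg (by norm_num) (measure_ne_top _ _))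
  have hle (g : Lp ℝ 2 ν) : eLpNorm g 1 ρ ≤ M * eLpNorm g 2 ν := by
    calc eLpNorm g 1 ρ = ∫⁻ x, ENNReal.ofReal (w x) * ‖g x‖ₑ ∂ν :=
          hw.eLpNorm_one (Lp.aestronglyMeasurable g)
      _ ≤ ∫⁻ x, ENNReal.ofReal D * ‖g x‖ₑ ∂ν := by
          refine lintegral_mono_ae ?_
          filter_upwards [hD] with x hx
          gcongr
      _ = ENNReal.ofReal D * eLpNorm g 1 ν := by
          rw [lintegral_const_mul'' _ (Lp.aestronglyMeasurable g).enorm,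
            eLpNorm_one_eq_lintegral_enorm]
      _ ≤ M * eLpNorm g 2 ν := by
          rw [mul_assoc, mul_comm (_ ^ _)]
          gcongr
          exact eLpNorm_le_eLpNorm_mul_rpow_measure_univ one_le_two (Lp.aestronglyMeasurable g)
  obtain ⟨j, -, hj⟩ := exists_clm_of_eLpNorm_le (σ := ρ) (q := 1) (fun g : Lp ℝ 2 ν => g)
    (fun g => (Lp.aestronglyMeasurable g).mono_ac hw.absolutelyContinuous)
    (fun f g => hw.absolutelyContinuous.ae_le (Lp.coeFn_add f g))
    (fun c f => hw.absolutelyContinuous.ae_le (Lp.coeFn_smul c f)) hM hle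
  exact ⟨j, fun g => hw.absolutelyContinuous'.ae_le (hj g)⟩

theorem denseRange_inclusion [IsFiniteMeasure ν] (hw : IsWeight ν ρ w)
    {j : Lp ℝ 2 ν →L[ℝ] Lp ℝ 1 ρ} (hj : ∀ g, j g =ᵐ[ν] g) : DenseRange j := by
  refine (Lp.simpleFunc.denseRange (μ := ρ) (E := ℝ) ENNReal.one_ne_top).mono ?_
  rintro _ ⟨f, rfl⟩
  have hf : MemLp (Lp.simpleFunc.toSimpleFunc f) 2 ν := SimpleFunc.memLp_of_isFiniteMeasure _ _ _
  refine ⟨hf.toLp, Lp.ext ?_⟩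
  filter_upwards [hw.absolutelyContinuous.ae_le ((hj hf.toLp).trans hf.coeFn_toLp),
    Lp.simpleFunc.toSimpleFunc_eq_toFun f] with x hx hx'
  rw [hx, hx']

end IsWeight

theorem norm_mul_le_mul_abs_mul {a b c v : ℝ} (h : |b| ≤ c * v) : ‖a * b‖ ≤ c * (|a| * v) := by
  rw [norm_mul, Real.norm_eq_abs, Real.norm_eq_abs, mul_left_comm]
  gcongr

namespace IsWeightBounded

theorem congr {ψ' : α → ℝ} (hψ : IsWeightBounded ν w ψ) (h : ψ =ᵐ[ν] ψ') :
    IsWeightBounded ν w ψ' := by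
  obtain ⟨hψm, C, hC⟩ := hψ
  refine ⟨hψm.congr h, C, ?_⟩
  filter_upwards [h, hC] with x hx hxC
  rwa [← hx]

theorem memLp_two [IsFiniteMeasure ν] (hw : IsWeight ν ρ w) (hψ : IsWeightBounded ν w ψ) :
    MemLp ψ 2 ν := by
  obtain ⟨hψm, C, hC⟩ := hψ
  obtain ⟨D, hD⟩ := hw.bounded
  refine MemLp.of_bound hψm (|C| * D) ?_
  filter_upwards [hC, hw.pos, hD] with x hx hpos hxD
  calc ‖ψ x‖ ≤ C * w x := hx
    _ ≤ |C| * D := by gcongr; exact le_abs_self C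

theorem exists_Lp_two [IsFiniteMeasure ν] (hw : IsWeight ν ρ w) (hψ : IsWeightBounded ν w ψ) :
    ∃ ψ₂ : Lp ℝ 2 ν, ψ =ᵐ[ν] ψ₂ ∧ IsWeightBounded ν w ψ₂ :=
  have hae := (hψ.memLp_two hw).coeFn_toLp.symm
  ⟨_, hae, hψ.congr hae⟩

theorem integrable_mul (hw : IsWeight ν ρ w) (hψ : IsWeightBounded ν w ψ) (f : Lp ℝ 1 ρ) :
    Integrable (fun x => f x * ψ x) ν := by
  obtain ⟨hψm, C, hC⟩ := hψ
  refine ((hw.integrable_abs_mul f).const_mul C).mono' ((hw.aestronglyMeasurable f).mul hψm) ?_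
  filter_upwards [hC] with x hx using norm_mul_le_mul_abs_mul hx

theorem exists_functional (hw : IsWeight ν ρ w) (hψ : IsWeightBounded ν w ψ) :
    ∃ Λ : Lp ℝ 1 ρ →L[ℝ] ℝ, ∀ f, Λ f = ∫ x, f x * ψ x ∂ν := by
  obtain ⟨C, hC⟩ := hψ.2
  let Λ : Lp ℝ 1 ρ →ₗ[ℝ] ℝ :=
    { toFun := fun f => ∫ x, f x * ψ x ∂ν
      map_add' := fun f g => by
        rw [← integral_add (hψ.integrable_mul hw f) (hψ.integrable_mul hw g)]
        refine integral_congr_ae ?_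
        filter_upwards [hw.absolutelyContinuous'.ae_le (Lp.coeFn_add f g)] with x hx
        rw [hx, Pi.add_apply, add_mul]
      map_smul' := fun c f => by
        rw [RingHom.id_apply, smul_eq_mul, ← integral_const_mul]
        refine integral_congr_ae ?_
        filter_upwards [hw.absolutelyContinuous'.ae_le (Lp.coeFn_smul c f)] with x hx
        rw [hx, Pi.smul_apply, smul_eq_mul, mul_assoc] }
  refine ⟨Λ.mkContinuous C fun f => ?_, fun f => rfl⟩
  rw [hw.norm_eq, ← integral_const_mul]
  refine norm_integral_le_of_norm_le ((hw.integrable_abs_mul f).const_mul C) ?_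
  filter_upwards [hC] with x hx using norm_mul_le_mul_abs_mul hx

end IsWeightBounded

theorem IsWeight.isWeightBounded_of_abs_inner_le [IsFiniteMeasure ν] (hw : IsWeight ν ρ w)
    {j : Lp ℝ 2 ν →L[ℝ] Lp ℝ 1 ρ} (hj : ∀ g, j g =ᵐ[ν] g) {C : ℝ} (g : Lp ℝ 2 ν)
    (hg : ∀ f, |inner ℝ f g| ≤ C * ‖j f‖) : IsWeightBounded ν w g := by
  obtain ⟨D, hD⟩ := hw.bounded
  have hgint : Integrable g ν := (Lp.memLp g).integrable one_le_two
  have hwint : Integrable (fun x => C * w x) ν := by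
    refine (Integrable.of_bound hw.measurable.aestronglyMeasurable D ?_).const_mul C
    filter_upwards [hw.pos, hD] with x hx hxD
    rwa [Real.norm_of_nonneg hx.le]
  have hset {S : Set α} (hS : MeasurableSet S) :
      |∫ x in S, g x ∂ν| ≤ ∫ x in S, C * w x ∂ν := by
    let f : Lp ℝ 2 ν := indicatorConstLp 2 hS (measure_ne_top ν S) 1
    have hf : (fun x => |j f x| * w x) =ᵐ[ν] S.indicator w := by
      filter_upwards [hj f, indicatorConstLp_coeFn (p := 2) (hs := hS)
        (hμs := measure_ne_top ν S) (c := (1 : ℝ))] with x hjx hx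
      rw [hjx, hx]
      by_cases hxS : x ∈ S <;> simp [hxS]
    have hbound := hg f
    rwa [hw.norm_eq, integral_congr_ae hf, integral_indicator hS, ← integral_const_mul,
      L2.inner_indicatorConstLp_one] at hbound
  refine ⟨Lp.aestronglyMeasurable g, C, ?_⟩
  have hle := ae_le_of_forall_setIntegral_le hgint hwint fun S hS _ =>
    (le_abs_self _).trans (hset hS)
  have hneg := ae_le_of_forall_setIntegral_le hgint.neg hwint fun S hS _ => by
    simp only [Pi.neg_apply, integral_neg]
    exact (neg_le_abs _).trans (hset hS)
  filter_upwards [hle, hneg] with x hx hx' using abs_le.2 ⟨neg_le.1 hx', hx⟩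

theorem inner_eq_integral_of_ae_eq {f g : Lp ℝ 2 ν} {f' : α → ℝ} (hf : f' =ᵐ[ν] f) :
    inner ℝ f g = ∫ x, f' x * g x ∂ν := by
  rw [L2.inner_def]
  refine integral_congr_ae ?_
  filter_upwards [hf] with x hx
  rw [hx, RCLike.inner_apply, conj_trivial, mul_comm]

section Duality

variable [IsFiniteMeasure ν] {j : Lp ℝ 2 ν →L[ℝ] Lp ℝ 1 ρ} {Γ : Lp ℝ 2 ν →L[ℝ] Lp ℝ 2 ν}
  {T : Lp ℝ 1 ρ →L[ℝ] Lp ℝ 1 ρ}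

theorem IsWeightBounded.of_intertwines (hw : IsWeight ν ρ w) (hj : ∀ g, j g =ᵐ[ν] g)
    (hT : T ∘L j = j ∘L Γ) (hΓ : (Γ : Lp ℝ 2 ν →ₗ[ℝ] Lp ℝ 2 ν).IsSymmetric) {ψ : Lp ℝ 2 ν}
    (hψ : IsWeightBounded ν w ψ) : IsWeightBounded ν w (Γ ψ) := by
  obtain ⟨Λ, hΛ⟩ := hψ.exists_functional hw
  refine hw.isWeightBounded_of_abs_inner_le hj (C := ‖Λ ∘L T‖) _ fun f => ?_
  have hTf : T (j f) = j (Γ f) := DFunLike.congr_fun hT f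
  have hΛf : inner ℝ f (Γ ψ) = (Λ ∘L T) (j f) := by
    rw [ContinuousLinearMap.comp_apply, hΛ, hTf, ← inner_eq_integral_of_ae_eq (hj _)]
    exact (hΓ f ψ).symm
  rw [hΛf]
  exact (Λ ∘L T).le_opNorm _

theorem IsWeightBounded.integral_apply_mul (hw : IsWeight ν ρ w) (hj : ∀ g, j g =ᵐ[ν] g)
    (hT : T ∘L j = j ∘L Γ) (hΓ : (Γ : Lp ℝ 2 ν →ₗ[ℝ] Lp ℝ 2 ν).IsSymmetric) {ψ : Lp ℝ 2 ν}
    (hψ : IsWeightBounded ν w ψ) (f : Lp ℝ 1 ρ) :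
    ∫ x, T f x * ψ x ∂ν = ∫ x, f x * Γ ψ x ∂ν := by
  obtain ⟨Λ, hΛ⟩ := hψ.exists_functional hw
  obtain ⟨Λ', hΛ'⟩ := (hψ.of_intertwines hw hj hT hΓ).exists_functional hw
  rw [← hΛ, ← hΛ']
  refine congrFun ((hw.denseRange_inclusion hj).equalizer (Λ ∘L T).continuous Λ'.continuous
    (funext fun g => ?_)) f
  have hTg : T (j g) = j (Γ g) := DFunLike.congr_fun hT g
  calc Λ (T (j g)) = inner ℝ (Γ g) ψ := by rw [hTg, hΛ, inner_eq_integral_of_ae_eq (hj _)]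
    _ = inner ℝ g (Γ ψ) := hΓ g ψ
    _ = Λ' (j g) := by rw [hΛ', inner_eq_integral_of_ae_eq (hj _)]

end Duality

end Weight

/-! ## Schur's test and splitting of kernels -/

/-- The hypotheses of Schur's test for the kernel `K`, with the constant `M`, both on `L²(ν)` (`row`
and `col`) and on `L¹(w ν)` (`weighted_col`). -/
structure IsSchurKernel {α : Type*} [MeasurableSpace α] (ν : Measure α) (w : α → ℝ)
    (K : α → α → ℝ) (M : ℝ≥0∞) : Prop where
  aestronglyMeasurable : AEStronglyMeasurable (fun z : α × α => K z.1 z.2) (ν.prod ν)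
  row : ∀ᵐ x ∂ν, ∫⁻ y, ‖K x y‖ₑ ∂ν ≤ M
  col : ∀ᵐ y ∂ν, ∫⁻ x, ‖K x y‖ₑ ∂ν ≤ M
  weighted_col : ∀ᵐ y ∂ν,
    ∫⁻ x, ‖K x y‖ₑ * ENNReal.ofReal (w x) ∂ν ≤ M * ENNReal.ofReal (w y)

/-- The kernel `K` is bounded by a multiple of the weight `w` in its second variable, so that it
defines an operator from `L¹(w ν)` to bounded functions. -/
structure IsWeightBoundedKernel {α : Type*} [MeasurableSpace α] (ν : Measure α) (w : α → ℝ)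
    (K : α → α → ℝ) : Prop where
  aestronglyMeasurable : AEStronglyMeasurable (fun z : α × α => K z.1 z.2) (ν.prod ν)
  bounded : ∃ C, ∀ᵐ x ∂ν, ∀ᵐ y ∂ν, |K x y| ≤ C * w y

section Schur

variable {α : Type*} [MeasurableSpace α] {ν ρ : Measure α} {w : α → ℝ} {K : α → α → ℝ} {M : ℝ≥0∞}

theorem aemeasurable_lintegral_kernel_mul [SFinite ν]
    (hK : AEStronglyMeasurable (fun z : α × α => K z.1 z.2) (ν.prod ν)) {f : α → ℝ}
    (hf : AEStronglyMeasurable f ν) :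
    AEMeasurable (fun x => ∫⁻ y, ‖K x y‖ₑ * ‖f y‖ₑ ∂ν) ν :=
  (hK.enorm.mul hf.comp_snd.enorm).lintegral_prod_right'

theorem sq_lintegral_mul_le {k g : α → ℝ≥0∞} (hk : AEMeasurable k ν) (hg : AEMeasurable g ν) :
    (∫⁻ y, k y * g y ∂ν) ^ (2 : ℝ) ≤ (∫⁻ y, k y ∂ν) * ∫⁻ y, k y * g y ^ (2 : ℝ) ∂ν := by
  have hsplit (y : α) :
      k y ^ (1 / 2 : ℝ) * (k y * g y ^ (2 : ℝ)) ^ (1 / 2 : ℝ) = k y * g y := by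
    rw [ENNReal.mul_rpow_of_nonneg _ _ (by norm_num), ← mul_assoc,
      ← ENNReal.rpow_add_of_nonneg _ _ (by norm_num) (by norm_num), ← ENNReal.rpow_mul]
    norm_num
  have hCS := ENNReal.lintegral_mul_norm_pow_le hk (hk.mul (hg.pow_const (2 : ℝ)))
    (p := 1 / 2) (q := 1 / 2) (by norm_num) (by norm_num) (by norm_num)
  simp only [Pi.mul_apply, hsplit] at hCS
  rw [← ENNReal.mul_rpow_of_nonneg _ _ (by norm_num)] at hCS
  have hsq := ENNReal.rpow_le_rpow hCS (z := 2) (by norm_num)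
  rwa [← ENNReal.rpow_mul, one_div, inv_mul_cancel₀ (by norm_num), ENNReal.rpow_one] at hsq

namespace IsSchurKernel

theorem eLpNorm_one_le [SFinite ν] (hw : IsWeight ν ρ w) (hK : IsSchurKernel ν w K M) {f : α → ℝ}
    (hf : AEStronglyMeasurable f ν) :
    eLpNorm (fun x => ∫⁻ y, ‖K x y‖ₑ * ‖f y‖ₑ ∂ν) 1 ρ ≤ M * eLpNorm f 1 ρ := by
  have hwm : AEMeasurable (fun x => ENNReal.ofReal (w x)) ν :=
    hw.measurable.ennreal_ofReal.aemeasurable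
  have hKf : AEMeasurable (fun z : α × α => ‖K z.1 z.2‖ₑ * ‖f z.2‖ₑ) (ν.prod ν) :=
    hK.aestronglyMeasurable.enorm.mul hf.comp_snd.enorm
  rw [hw.eLpNorm_one hf, eLpNorm_one_eq_lintegral_enorm, hw.eq_withDensity]
  simp only [enorm_eq_self]
  rw [lintegral_withDensity_eq_lintegral_mul₀ hwm hKf.lintegral_prod_right']
  calc ∫⁻ x, ENNReal.ofReal (w x) * ∫⁻ y, ‖K x y‖ₑ * ‖f y‖ₑ ∂ν ∂ν
      = ∫⁻ x, ∫⁻ y, ENNReal.ofReal (w x) * (‖K x y‖ₑ * ‖f y‖ₑ) ∂ν ∂ν := by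
        simp only [lintegral_const_mul' _ _ ENNReal.ofReal_ne_top]
    _ = ∫⁻ y, ∫⁻ x, ENNReal.ofReal (w x) * (‖K x y‖ₑ * ‖f y‖ₑ) ∂ν ∂ν :=
        lintegral_lintegral_swap (hwm.comp_fst.mul hKf)
    _ = ∫⁻ y, (∫⁻ x, ‖K x y‖ₑ * ENNReal.ofReal (w x) ∂ν) * ‖f y‖ₑ ∂ν := by
        simp only [← lintegral_mul_const' _ _ enorm_ne_top, mul_left_comm, mul_comm]
    _ ≤ ∫⁻ y, M * (ENNReal.ofReal (w y) * ‖f y‖ₑ) ∂ν := by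
        refine lintegral_mono_ae ?_
        filter_upwards [hK.weighted_col] with y hy
        rw [← mul_assoc]
        gcongr
    _ = M * ∫⁻ y, ENNReal.ofReal (w y) * ‖f y‖ₑ ∂ν := lintegral_const_mul'' _ (hwm.mul hf.enorm)

theorem eLpNorm_two_le [SFinite ν] (hK : IsSchurKernel ν w K M) {f : α → ℝ}
    (hf : AEStronglyMeasurable f ν) :
    eLpNorm (fun x => ∫⁻ y, ‖K x y‖ₑ * ‖f y‖ₑ ∂ν) 2 ν ≤ M * eLpNorm f 2 ν := by
  have hKm := hK.aestronglyMeasurable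
  have hKf : AEMeasurable (fun z : α × α => ‖K z.1 z.2‖ₑ * ‖f z.2‖ₑ ^ (2 : ℝ)) (ν.prod ν) :=
    hKm.enorm.mul (hf.comp_snd.enorm.pow_const (2 : ℝ))
  have hsq : ∫⁻ x, (∫⁻ y, ‖K x y‖ₑ * ‖f y‖ₑ ∂ν) ^ (2 : ℝ) ∂ν ≤
      M ^ (2 : ℝ) * ∫⁻ y, ‖f y‖ₑ ^ (2 : ℝ) ∂ν := by
    calc ∫⁻ x, (∫⁻ y, ‖K x y‖ₑ * ‖f y‖ₑ ∂ν) ^ (2 : ℝ) ∂ν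
        ≤ ∫⁻ x, M * ∫⁻ y, ‖K x y‖ₑ * ‖f y‖ₑ ^ (2 : ℝ) ∂ν ∂ν := by
          refine lintegral_mono_ae ?_
          filter_upwards [hK.row, hKm.prodMk_left] with x hx hxm
          refine (sq_lintegral_mul_le hxm.enorm hf.enorm).trans ?_
          gcongr
      _ = M * ∫⁻ y, ∫⁻ x, ‖K x y‖ₑ * ‖f y‖ₑ ^ (2 : ℝ) ∂ν ∂ν := by
          rw [lintegral_const_mul'' _ hKf.lintegral_prod_right', lintegral_lintegral_swap hKf]
      _ ≤ M * ∫⁻ y, M * ‖f y‖ₑ ^ (2 : ℝ) ∂ν := by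
          refine mul_le_mul_right (lintegral_mono_ae ?_) _
          filter_upwards [hK.col] with y hy
          rw [lintegral_mul_const' _ _ (by finiteness)]
          gcongr
      _ = M ^ (2 : ℝ) * ∫⁻ y, ‖f y‖ₑ ^ (2 : ℝ) ∂ν := by
          rw [lintegral_const_mul'' _ (hf.enorm.pow_const _), ← mul_assoc, ENNReal.rpow_two, sq]
  simp only [eLpNorm_eq_lintegral_rpow_enorm_toReal two_ne_zero ENNReal.ofNat_ne_top,
    enorm_eq_self, ENNReal.toReal_ofNat]
  refine (ENNReal.rpow_le_rpow hsq (by norm_num)).trans_eq ?_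
  rw [ENNReal.mul_rpow_of_nonneg _ _ (by norm_num), ← ENNReal.rpow_mul]
  norm_num

theorem exists_operator_two [SFinite ν] (hK : IsSchurKernel ν w K M) (hM : M ≠ ⊤) :
    ∃ A : Lp ℝ 2 ν →L[ℝ] Lp ℝ 2 ν, ‖A‖ ≤ M.toReal ∧ IsKernelOp ν K A :=
  exists_isKernelOp hK.aestronglyMeasurable .rfl .rfl .rfl hM fun _ hf => hK.eLpNorm_two_le hf

theorem exists_operator_one [SFinite ν] (hw : IsWeight ν ρ w) (hK : IsSchurKernel ν w K M)
    (hM : M ≠ ⊤) : ∃ A : Lp ℝ 1 ρ →L[ℝ] Lp ℝ 1 ρ, ‖A‖ ≤ M.toReal ∧ IsKernelOp ν K A :=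
  exists_isKernelOp hK.aestronglyMeasurable hw.absolutelyContinuous' hw.absolutelyContinuous'
    hw.absolutelyContinuous hM fun _ hf => hK.eLpNorm_one_le hw hf

theorem integrable_prod_mul [SFinite ν] (hK : IsSchurKernel ν w K M) (hM : M ≠ ⊤)
    (f g : Lp ℝ 2 ν) : Integrable (fun z : α × α => K z.1 z.2 * f z.2 * g z.1) (ν.prod ν) := by
  have hf := Lp.aestronglyMeasurable f
  have hg := Lp.aestronglyMeasurable g
  have hmeas : AEStronglyMeasurable (fun z : α × α => K z.1 z.2 * f z.2 * g z.1) (ν.prod ν) :=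
    (hK.aestronglyMeasurable.mul hf.comp_snd).mul hg.comp_fst
  have hKf := hK.eLpNorm_two_le hf |>.trans_lt (ENNReal.mul_lt_top hM.lt_top (Lp.eLpNorm_lt_top f))
  have hg2 := Lp.eLpNorm_lt_top g
  rw [eLpNorm_eq_lintegral_rpow_enorm_toReal two_ne_zero ENNReal.ofNat_ne_top] at hKf hg2
  simp only [enorm_eq_self, ENNReal.toReal_ofNat] at hKf hg2
  refine ⟨hmeas, ?_⟩
  rw [hasFiniteIntegral_iff_enorm]
  calc ∫⁻ z, ‖K z.1 z.2 * f z.2 * g z.1‖ₑ ∂(ν.prod ν)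
      = ∫⁻ x, (∫⁻ y, ‖K x y‖ₑ * ‖f y‖ₑ ∂ν) * ‖g x‖ₑ ∂ν := by
        rw [lintegral_prod _ hmeas.enorm]
        simp only [enorm_mul, lintegral_mul_const' _ _ enorm_ne_top]
    _ ≤ _ := ENNReal.lintegral_mul_le_Lp_mul_Lq ν Real.HolderConjugate.two_two
        (aemeasurable_lintegral_kernel_mul hK.aestronglyMeasurable hf) hg.enorm
    _ < ⊤ := ENNReal.mul_lt_top hKf hg2

theorem isSymmetric [SFinite ν] (hK : IsSchurKernel ν w K M) (hM : M ≠ ⊤)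
    (hsymm : ∀ᵐ x ∂ν, ∀ᵐ y ∂ν, K y x = K x y) {A : Lp ℝ 2 ν →L[ℝ] Lp ℝ 2 ν}
    (hA : IsKernelOp ν K A) : (A : Lp ℝ 2 ν →ₗ[ℝ] Lp ℝ 2 ν).IsSymmetric := by
  intro f g
  calc inner ℝ (A f) g = ∫ x, ∫ y, K x y * f y * g x ∂ν ∂ν := by
        rw [inner_eq_integral_of_ae_eq (hA f).2.symm]
        simp only [integral_mul_const]
    _ = ∫ y, ∫ x, K x y * f y * g x ∂ν ∂ν :=
        integral_integral_swap (hK.integrable_prod_mul hM f g)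
    _ = ∫ y, A g y * f y ∂ν := by
        refine integral_congr_ae ?_
        filter_upwards [(hA g).2, hsymm] with y hy hsy
        rw [hy, ← integral_mul_const]
        refine integral_congr_ae ?_
        filter_upwards [hsy] with x hx
        rw [hx, mul_right_comm]
    _ = inner ℝ f (A g) := by
        rw [real_inner_comm, inner_eq_integral_of_ae_eq EventuallyEq.rfl]

end IsSchurKernel

theorem IsKernelOp.isCompactOperator [IsFiniteMeasure ν]
    (hK : AEStronglyMeasurable (fun z : α × α => K z.1 z.2) (ν.prod ν))
    {b : ℝ} (hb : ∀ᵐ x ∂ν, ∀ᵐ y ∂ν, ‖K x y‖ ≤ b) {T : Lp ℝ 2 ν →L[ℝ] Lp ℝ 2 ν}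
    (hT : IsKernelOp ν K T) : IsCompactOperator T := by
  obtain ⟨_, e, -⟩ := exists_hilbertBasis ℝ (Lp ℝ 2 ν)
  let c : ℝ := (measureUnivNNReal ν : ℝ) ^ (2 : ℝ≥0∞).toReal⁻¹ * |b|
  have hnorm (f : Lp ℝ 2 ν) : ‖f‖ ^ 2 = ∫ x, f x ^ 2 ∂ν := by
    rw [← real_inner_self_eq_norm_sq, inner_eq_integral_of_ae_eq EventuallyEq.rfl]
    simp only [sq]
  have hint (f : Lp ℝ 2 ν) : Integrable (fun x => f x ^ 2) ν := (Lp.memLp f).integrable_sq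
  refine isCompactOperator_of_sum_norm_sq_le e T (ν.real univ * c ^ 2) fun F => ?_
  have hTe : ∀ᵐ x ∂ν, ∀ i ∈ F, T (e i) x = ∫ y, K x y * e i y ∂ν :=
    (ae_ball_iff F.countable_toSet).2 fun i _ => (hT (e i)).2
  have hpointwise : ∀ᵐ x ∂ν, ∑ i ∈ F, T (e i) x ^ 2 ≤ c ^ 2 := by
    filter_upwards [hTe, hb, hK.prodMk_left] with x hx hbx hxm
    have hbx' : ∀ᵐ y ∂ν, ‖K x y‖ ≤ |b| := hbx.mono fun y hy => hy.trans (le_abs_self b)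
    have hmem : MemLp (K x) 2 ν := MemLp.of_bound hxm |b| hbx'
    have hkc : ‖hmem.toLp‖ ≤ c := Lp.norm_le_of_ae_bound (abs_nonneg b) (by
      filter_upwards [hmem.coeFn_toLp, hbx'] with y hy hby
      rwa [hy])
    calc ∑ i ∈ F, T (e i) x ^ 2 = ∑ i ∈ F, ‖(inner ℝ (e i) hmem.toLp : ℝ)‖ ^ 2 :=
          Finset.sum_congr rfl fun i hi => by
            rw [hx i hi, real_inner_comm, inner_eq_integral_of_ae_eq hmem.coeFn_toLp.symm,
              Real.norm_eq_abs, sq_abs]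
      _ ≤ ‖hmem.toLp‖ ^ 2 := e.orthonormal.sum_inner_products_le _
      _ ≤ c ^ 2 := by gcongr
  simp only [hnorm]
  rw [← integral_finsetSum _ fun i _ => hint _]
  calc ∫ x, ∑ i ∈ F, T (e i) x ^ 2 ∂ν ≤ ∫ _, c ^ 2 ∂ν :=
        integral_mono_ae (integrable_finsetSum _ fun i _ => hint _) (integrable_const _) hpointwise
    _ = ν.real univ * c ^ 2 := by simp

namespace IsWeightBoundedKernel

theorem exists_operator [IsFiniteMeasure ν] (hw : IsWeight ν ρ w)
    (hK : IsWeightBoundedKernel ν w K) :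
    ∃ B : Lp ℝ 1 ρ →L[ℝ] Lp ℝ 2 ν, IsKernelOp ν K B := by
  obtain ⟨C, hC⟩ := hK.bounded
  have hrow {f : α → ℝ} (hf : AEStronglyMeasurable f ν) :
      ∀ᵐ x ∂ν, ‖∫⁻ y, ‖K x y‖ₑ * ‖f y‖ₑ ∂ν‖ₑ ≤ ENNReal.ofReal |C| * eLpNorm f 1 ρ := by
    rw [hw.eLpNorm_one hf]
    filter_upwards [hC] with x hx
    rw [enorm_eq_self, ← lintegral_const_mul' _ _ ENNReal.ofReal_ne_top]
    refine lintegral_mono_ae ?_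
    filter_upwards [hx, hw.pos] with y hy hpos
    rw [← mul_assoc, ← ENNReal.ofReal_mul (abs_nonneg C), Real.enorm_eq_ofReal_abs]
    gcongr
    exact hy.trans (mul_le_mul_of_nonneg_right (le_abs_self C) hpos.le)
  let M : ℝ≥0∞ := ν univ ^ (2 : ℝ≥0∞).toReal⁻¹ * ENNReal.ofReal |C|
  have hM : M ≠ ⊤ := by finiteness
  obtain ⟨B, -, hB⟩ := exists_isKernelOp (p := 1) (q := 2) hK.aestronglyMeasurable
    hw.absolutelyContinuous' (σ := ν) .rfl .rfl hM fun f hf => by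
      refine (eLpNorm_le_of_ae_enorm_bound (hrow hf)).trans_eq ?_
      rw [smul_eq_mul]
      ring
  exact ⟨B, hB⟩

theorem isCompactOperator [IsFiniteMeasure ν] (hw : IsWeight ν ρ w)
    (hK : IsWeightBoundedKernel ν w K) {A : Lp ℝ 2 ν →L[ℝ] Lp ℝ 2 ν} (hA : IsKernelOp ν K A) :
    IsCompactOperator A := by
  obtain ⟨C, hC⟩ := hK.bounded
  obtain ⟨D, hD⟩ := hw.bounded
  refine hA.isCompactOperator hK.aestronglyMeasurable (b := |C| * D) ?_
  filter_upwards [hC] with x hx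
  filter_upwards [hx, hw.pos, hD] with y hy hpos hyD
  calc ‖K x y‖ ≤ C * w y := hy
    _ ≤ |C| * D := by gcongr; exact le_abs_self C

end IsWeightBoundedKernel

theorem isSmoothingPair_of_split [IsFiniteMeasure ν] (hw : IsWeight ν ρ w)
    {j : Lp ℝ 2 ν →L[ℝ] Lp ℝ 1 ρ} (hj : ∀ g, j g =ᵐ[ν] g) {A : Lp ℝ 2 ν →L[ℝ] Lp ℝ 2 ν}
    {A' : Lp ℝ 1 ρ →L[ℝ] Lp ℝ 1 ρ} (hA : IsKernelOp ν K A) (hA' : IsKernelOp ν K A')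
    (hsplit : ∀ η > 0, ∃ (N F : α → α → ℝ) (M : ℝ≥0∞), M ≠ ⊤ ∧ M.toReal ≤ η ∧ K = N + F ∧
      IsSchurKernel ν w N M ∧ IsWeightBoundedKernel ν w F) : IsSmoothingPair j A A' := by
  intro η hη
  obtain ⟨N, F, M, hM, hMη, rfl, hN, hF⟩ := hsplit η hη
  obtain ⟨R, hRM, hR⟩ := hN.exists_operator_two hM
  obtain ⟨R', hRM', hR'⟩ := hN.exists_operator_one hw hM
  obtain ⟨B, hB⟩ := hF.exists_operator hw
  have hac := hw.absolutelyContinuous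
  have hac' := hw.absolutelyContinuous'
  refine ⟨R, R', B, hRM.trans hMη, hRM'.trans hMη, ?_, ?_, ?_, ?_⟩
  · exact hA.ext .rfl (hR.add .rfl (hB.comp hj))
  · exact hA'.ext hac (hR'.add hac' (hB.of_ae_eq fun f => hj (B f)))
  · exact (hR.of_ae_eq fun f => hj (R f)).ext hac (hR'.comp hj)
  · exact hF.isCompactOperator hw (hB.comp hj)

end Schur

/-! ## Kernels dominated by the reference kernel -/

/-- The measure on `ℝⁿ` with density the Riesz kernel `|z|^(2s-n)`. -/
noncomputable def rieszMeasure (n : ℕ) (s : ℝ) : Measure (E n) :=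
  volume.withDensity fun z => ENNReal.ofReal (‖z‖ ^ (2 * s - n))

/-- A measurable kernel on `Ω × Ω` which is bounded by `C` times the reference kernel off the
diagonal. -/
structure IsDominatedKernel {n : ℕ} (Ω : Set (E n)) (s γ C : ℝ) (K : E n → E n → ℝ) : Prop where
  aestronglyMeasurable : AEStronglyMeasurable (fun z : E n × E n => K z.1 z.2)
    ((volume.restrict Ω).prod (volume.restrict Ω))
  abs_le : ∀ x ∈ Ω, ∀ y ∈ Ω, x ≠ y → |K x y| ≤ C * refKernel Ω s γ x y

section Domain

variable {n : ℕ} {Ω : Set (E n)} {s γ C : ℝ} {K : E n → E n → ℝ}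

theorem bdist_nonneg (Ω : Set (E n)) (x : E n) : 0 ≤ bdist Ω x := Metric.infDist_nonneg

theorem bdist_le_bdist_add_norm_sub (Ω : Set (E n)) (x y : E n) :
    bdist Ω x ≤ bdist Ω y + ‖x - y‖ := by
  rw [← dist_eq_norm]
  exact Metric.infDist_le_infDist_add_dist

theorem bdist_pos [Nonempty (Fin n)] (hΩo : IsOpen Ω) (hΩb : Bornology.IsBounded Ω) {x : E n}
    (hx : x ∈ Ω) : 0 < bdist Ω x := by
  have hne : (frontier Ω).Nonempty := nonempty_frontier_iff.2 ⟨⟨x, hx⟩, fun h =>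
    NormedSpace.unbounded_univ ℝ (E n) (h ▸ hΩb)⟩
  refine (isClosed_frontier.notMem_iff_infDist_pos hne).1 fun h => ?_
  rw [hΩo.frontier_eq] at h
  exact h.2 hx

theorem exists_norm_sub_lt (hΩb : Bornology.IsBounded Ω) :
    ∃ D : ℝ, ∀ x ∈ Ω, ∀ y ∈ Ω, ‖x - y‖ < D := by
  obtain ⟨D, hD⟩ := Metric.isBounded_iff.1 hΩb
  refine ⟨D + 1, fun x hx y hy => ?_⟩
  rw [← dist_eq_norm]
  exact (hD hx hy).trans_lt (lt_add_one D)

theorem exists_bdist_le (hΩb : Bornology.IsBounded Ω) : ∃ D : ℝ, ∀ x ∈ Ω, bdist Ω x ≤ D := by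
  obtain ⟨D, hD⟩ := isBounded_iff_forall_norm_le.1 hΩb
  refine ⟨bdist Ω 0 + D, fun x hx => (bdist_le_bdist_add_norm_sub Ω x 0).trans ?_⟩
  rw [sub_zero]
  exact add_le_add_right (hD x hx) _

theorem isFiniteMeasure_restrict_of_isBounded (hΩb : Bornology.IsBounded Ω) :
    IsFiniteMeasure ((volume : Measure (E n)).restrict Ω) :=
  MeasureTheory.isFiniteMeasure_restrict.2 hΩb.measure_lt_top.ne

theorem isWeight_bdist_rpow [Nonempty (Fin n)] (hΩo : IsOpen Ω) (hΩb : Bornology.IsBounded Ω)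
    (hγ : 0 ≤ γ) :
    IsWeight (volume.restrict Ω) (weightedMeasure Ω γ) (fun x => bdist Ω x ^ γ) where
  measurable := (Metric.continuous_infDist_pt _).measurable.pow_const γ
  pos := by
    filter_upwards [ae_restrict_mem hΩo.measurableSet] with x hx
    exact Real.rpow_pos_of_pos (bdist_pos hΩo hΩb hx) γ
  bounded := by
    obtain ⟨D, hD⟩ := exists_bdist_le hΩb
    refine ⟨D ^ γ, ?_⟩
    filter_upwards [ae_restrict_mem hΩo.measurableSet] with x hx
    exact Real.rpow_le_rpow (bdist_nonneg Ω x) (hD x hx) hγ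
  eq_withDensity := rfl

theorem rieszMeasure_ball_ne_top [Nonempty (Fin n)] (hs : 0 < s) (r : ℝ) :
    rieszMeasure n s (Metric.ball 0 r) ≠ ⊤ := by
  have hint : IntegrableOn (fun z : E n => ‖z‖ ^ (2 * s - n)) (Metric.ball 0 r) := by
    refine integrableOn_ball_of_norm_le_rpow (C := 1) (α := n - 2 * s)
      (by rw [finrank_euclideanSpace_fin]; exact Fin.pos_iff_nonempty.2 ‹_›)
      (by rw [finrank_euclideanSpace_fin]; linarith)
      (Eventually.of_forall fun z => ?_) (measurable_norm.pow_const _).aestronglyMeasurable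
    rw [neg_sub, one_mul, Real.norm_of_nonneg (by positivity)]
  rw [rieszMeasure, withDensity_apply _ Metric.isOpen_ball.measurableSet]
  exact ((hasFiniteIntegral_iff_ofReal (Eventually.of_forall fun z => by positivity)).1
    hint.hasFiniteIntegral).ne

theorem tendsto_rieszMeasure_ball [Nonempty (Fin n)] (hs : 0 < s) :
    Tendsto (fun r => rieszMeasure n s (Metric.ball 0 r)) (𝓝[>] 0) (𝓝 0) := by
  have hlim := tendsto_measure_biInter_gt (μ := rieszMeasure n s) (a := (0 : ℝ))
    (s := Metric.ball (0 : E n)) (fun r _ => Metric.isOpen_ball.measurableSet.nullMeasurableSet)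
    (fun i j _ hij => Metric.ball_subset_ball hij) ⟨1, one_pos, rieszMeasure_ball_ne_top hs 1⟩
  have hzero : rieszMeasure n s {0} = 0 :=
    withDensity_absolutelyContinuous _ _ (measure_singleton 0)
  rwa [Metric.biInter_gt_ball, Metric.closedBall_zero, hzero] at hlim

theorem lintegral_ofReal_le_mul_rieszMeasure_ball [Nonempty (Fin n)] (hΩ : MeasurableSet Ω)
    {κ : E n → ℝ} {a r : ℝ} (ha : 0 ≤ a) (x : E n)
    (hnear : ∀ y ∈ Ω, x ≠ y → κ y ≤ a * ‖x - y‖ ^ (2 * s - n))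
    (hfar : ∀ y ∈ Ω, r ≤ ‖x - y‖ → κ y ≤ 0) :
    ∫⁻ y in Ω, ENNReal.ofReal (κ y) ≤
      ENNReal.ofReal a * rieszMeasure n s (Metric.ball 0 r) := by
  let ρ : E n → ℝ≥0∞ := (Metric.ball 0 r).indicator fun z => ENNReal.ofReal (‖z‖ ^ (2 * s - n))
  have hle : ∀ᵐ y ∂(volume.restrict Ω), ENNReal.ofReal (κ y) ≤ ENNReal.ofReal a * ρ (x - y) := by
    filter_upwards [ae_restrict_mem hΩ, ae_restrict_of_ae (Measure.ae_ne volume x)] with y hy hne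
    by_cases hr : ‖x - y‖ < r
    · rw [show ρ (x - y) = _ from indicator_of_mem (mem_ball_zero_iff.2 hr) _,
        ← ENNReal.ofReal_mul ha]
      exact ENNReal.ofReal_le_ofReal (hnear y hy hne.symm)
    · rw [ENNReal.ofReal_of_nonpos (hfar y hy (not_lt.1 hr))]
      exact zero_le
  calc ∫⁻ y in Ω, ENNReal.ofReal (κ y)
      ≤ ∫⁻ y in Ω, ENNReal.ofReal a * ρ (x - y) := lintegral_mono_ae hle
    _ = ENNReal.ofReal a * ∫⁻ y in Ω, ρ (x - y) := lintegral_const_mul' _ _ ENNReal.ofReal_ne_top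
    _ ≤ ENNReal.ofReal a * ∫⁻ y, ρ (x - y) := by gcongr; exact Measure.restrict_le_self
    _ = ENNReal.ofReal a * rieszMeasure n s (Metric.ball 0 r) := by
      rw [lintegral_sub_left_eq_self, lintegral_indicator Metric.isOpen_ball.measurableSet,
        rieszMeasure, withDensity_apply _ Metric.isOpen_ball.measurableSet]

theorem refKernel_nonneg (Ω : Set (E n)) (s γ : ℝ) (x y : E n) : 0 ≤ refKernel Ω s γ x y := by
  have hx := bdist_nonneg Ω x
  have hy := bdist_nonneg Ω y
  unfold refKernel
  positivity

theorem refKernel_le_rpow_mul_min (Ω : Set (E n)) (s γ : ℝ) (x y : E n) :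
    refKernel Ω s γ x y ≤ ‖x - y‖ ^ (2 * s - n) * min (bdist Ω y ^ γ / ‖x - y‖ ^ γ) 1 := by
  have hy := bdist_nonneg Ω y
  rw [refKernel, ← neg_sub (n : ℝ), Real.rpow_neg (norm_nonneg _), one_div]
  gcongr
  exact mul_le_of_le_one_right (by positivity) (min_le_right _ _)

theorem refKernel_le_rpow (Ω : Set (E n)) (s γ : ℝ) (x y : E n) :
    refKernel Ω s γ x y ≤ ‖x - y‖ ^ (2 * s - n) :=
  (refKernel_le_rpow_mul_min Ω s γ x y).trans
    (mul_le_of_le_one_right (by positivity) (min_le_right _ _))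

theorem refKernel_mul_norm_rpow_le (Ω : Set (E n)) (s γ : ℝ) {x y : E n} (hxy : x ≠ y) :
    refKernel Ω s γ x y * ‖x - y‖ ^ γ ≤ ‖x - y‖ ^ (2 * s - n) * bdist Ω y ^ γ := by
  have ht : 0 < ‖x - y‖ := norm_pos_iff.2 (sub_ne_zero.2 hxy)
  rw [← le_div_iff₀ (by positivity), mul_div_assoc]
  exact (refKernel_le_rpow_mul_min Ω s γ x y).trans
    (mul_le_mul_of_nonneg_left (min_le_left _ _) (by positivity))

theorem refKernel_mul_bdist_rpow_le (hγ : 0 ≤ γ) (Ω : Set (E n)) (s : ℝ) {x y : E n}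
    (hxy : x ≠ y) :
    refKernel Ω s γ x y * bdist Ω x ^ γ ≤ 2 ^ γ * ‖x - y‖ ^ (2 * s - n) * bdist Ω y ^ γ := by
  have hx := bdist_nonneg Ω x
  have hy := bdist_nonneg Ω y
  have hadd := bdist_le_bdist_add_norm_sub Ω x y
  have hk := refKernel_nonneg Ω s γ x y
  rcases le_total ‖x - y‖ (bdist Ω y) with h | h
  · calc refKernel Ω s γ x y * bdist Ω x ^ γ
        ≤ ‖x - y‖ ^ (2 * s - n) * (2 * bdist Ω y) ^ γ := by
          gcongr
          · exact refKernel_le_rpow Ω s γ x y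
          · linarith
      _ = 2 ^ γ * ‖x - y‖ ^ (2 * s - n) * bdist Ω y ^ γ := by
          rw [Real.mul_rpow two_pos.le hy]; ring
  · calc refKernel Ω s γ x y * bdist Ω x ^ γ
        ≤ refKernel Ω s γ x y * (2 * ‖x - y‖) ^ γ := by gcongr; linarith
      _ = 2 ^ γ * (refKernel Ω s γ x y * ‖x - y‖ ^ γ) := by
          rw [Real.mul_rpow two_pos.le (norm_nonneg _)]; ring
      _ ≤ 2 ^ γ * (‖x - y‖ ^ (2 * s - n) * bdist Ω y ^ γ) := by
          exact mul_le_mul_of_nonneg_left (refKernel_mul_norm_rpow_le Ω s γ hxy) (by positivity)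
      _ = 2 ^ γ * ‖x - y‖ ^ (2 * s - n) * bdist Ω y ^ γ := by ring

theorem rpow_le_rpow_add_rpow {ε t D : ℝ} (hε : 0 < ε) (hεt : ε ≤ t) (htD : t ≤ D) (p : ℝ) :
    t ^ p ≤ ε ^ p + D ^ p := by
  have ht : 0 < t := hε.trans_le hεt
  have hD : 0 < D := ht.trans_le htD
  rcases le_total 0 p with hp | hp
  · exact (Real.rpow_le_rpow ht.le htD hp).trans (le_add_of_nonneg_left (by positivity))
  · exact (Real.rpow_le_rpow_of_nonpos hε hεt hp).trans (le_add_of_nonneg_right (by positivity))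

namespace IsDominatedKernel

theorem indicator (hK : IsDominatedKernel Ω s γ C K) (hC : 0 ≤ C) {S : Set (E n × E n)}
    (hS : MeasurableSet S) :
    IsDominatedKernel Ω s γ C (fun x y => S.indicator (fun z => K z.1 z.2) (x, y)) where
  aestronglyMeasurable := hK.aestronglyMeasurable.indicator hS
  abs_le x hx y hy hxy := by
    by_cases h : (x, y) ∈ S
    · rw [indicator_of_mem h]
      exact hK.abs_le x hx y hy hxy
    · rw [indicator_of_notMem h, abs_zero]
      exact mul_nonneg hC (refKernel_nonneg Ω s γ x y)

theorem abs_mul_bdist_rpow_le (hK : IsDominatedKernel Ω s γ C K) (hC : 0 ≤ C) (hγ : 0 ≤ γ)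
    {x y : E n} (hx : x ∈ Ω) (hy : y ∈ Ω) (hxy : x ≠ y) :
    |K x y| * bdist Ω x ^ γ ≤ 2 ^ γ * C * bdist Ω y ^ γ * ‖x - y‖ ^ (2 * s - n) := by
  have hb := bdist_nonneg Ω x
  calc |K x y| * bdist Ω x ^ γ ≤ C * refKernel Ω s γ x y * bdist Ω x ^ γ := by
        gcongr; exact hK.abs_le x hx y hy hxy
    _ = C * (refKernel Ω s γ x y * bdist Ω x ^ γ) := by ring
    _ ≤ C * (2 ^ γ * ‖x - y‖ ^ (2 * s - n) * bdist Ω y ^ γ) := by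
        exact mul_le_mul_of_nonneg_left (refKernel_mul_bdist_rpow_le hγ Ω s hxy) hC
    _ = _ := by ring

theorem abs_le_mul_rpow (hK : IsDominatedKernel Ω s γ C K) (hC : 0 ≤ C) (hγ : 0 ≤ γ) {x y : E n}
    (hx : x ∈ Ω) (hy : y ∈ Ω) (hxy : x ≠ y) :
    |K x y| ≤ 2 ^ γ * C * ‖x - y‖ ^ (2 * s - n) :=
  calc |K x y| ≤ C * ‖x - y‖ ^ (2 * s - n) := (hK.abs_le x hx y hy hxy).trans
        (mul_le_mul_of_nonneg_left (refKernel_le_rpow Ω s γ x y) hC)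
    _ ≤ 2 ^ γ * C * ‖x - y‖ ^ (2 * s - n) := by
        rw [mul_assoc]
        exact le_mul_of_one_le_left (by positivity) (Real.one_le_rpow one_le_two hγ)

theorem isSchurKernel [Nonempty (Fin n)] (hK : IsDominatedKernel Ω s γ C K) (hC : 0 ≤ C)
    (hγ : 0 ≤ γ) (hΩ : MeasurableSet Ω) {r : ℝ}
    (hnear : ∀ x ∈ Ω, ∀ y ∈ Ω, r ≤ ‖x - y‖ → K x y = 0) :
    IsSchurKernel (volume.restrict Ω) (fun x => bdist Ω x ^ γ) K
      (ENNReal.ofReal (2 ^ γ * C) * rieszMeasure n s (Metric.ball 0 r)) where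
  aestronglyMeasurable := hK.aestronglyMeasurable
  row := by
    filter_upwards [ae_restrict_mem hΩ] with x hx
    simp only [Real.enorm_eq_ofReal_abs]
    refine lintegral_ofReal_le_mul_rieszMeasure_ball hΩ (by positivity) x
      (fun y hy hxy => hK.abs_le_mul_rpow hC hγ hx hy hxy) fun y hy hr => ?_
    rw [hnear x hx y hy hr, abs_zero]
  col := by
    filter_upwards [ae_restrict_mem hΩ] with y hy
    simp only [Real.enorm_eq_ofReal_abs]
    refine lintegral_ofReal_le_mul_rieszMeasure_ball hΩ (by positivity) y
      (fun x hx hxy => ?_) fun x hx hr => ?_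
    · rw [norm_sub_rev]
      exact hK.abs_le_mul_rpow hC hγ hx hy hxy.symm
    · rw [hnear x hx y hy (norm_sub_rev x y ▸ hr), abs_zero]
  weighted_col := by
    filter_upwards [ae_restrict_mem hΩ] with y hy
    have hb := bdist_nonneg Ω y
    simp only [Real.enorm_eq_ofReal_abs, ← ENNReal.ofReal_mul (abs_nonneg _)]
    rw [mul_right_comm, ← ENNReal.ofReal_mul (by positivity)]
    refine lintegral_ofReal_le_mul_rieszMeasure_ball hΩ (by positivity) y
      (fun x hx hxy => ?_) fun x hx hr => ?_
    · rw [norm_sub_rev]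
      exact hK.abs_mul_bdist_rpow_le hC hγ hx hy hxy.symm
    · rw [hnear x hx y hy (norm_sub_rev x y ▸ hr), abs_zero, zero_mul]

theorem isWeightBoundedKernel (hK : IsDominatedKernel Ω s γ C K) (hC : 0 ≤ C) (hγ : 0 ≤ γ)
    (hΩ : MeasurableSet Ω) (hΩb : Bornology.IsBounded Ω) {ε : ℝ} (hε : 0 < ε)
    (hfar : ∀ x ∈ Ω, ∀ y ∈ Ω, ‖x - y‖ < ε → K x y = 0) :
    IsWeightBoundedKernel (volume.restrict Ω) (fun x => bdist Ω x ^ γ) K where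
  aestronglyMeasurable := hK.aestronglyMeasurable
  bounded := by
    obtain ⟨D, hD⟩ := exists_norm_sub_lt hΩb
    let P := ε ^ (2 * s - n) + D ^ (2 * s - n)
    refine ⟨C * P / ε ^ γ, ?_⟩
    filter_upwards [ae_restrict_mem hΩ] with x hx
    filter_upwards [ae_restrict_mem hΩ] with y hy
    have hb := bdist_nonneg Ω y
    have hD0 : 0 ≤ D := (norm_nonneg _).trans (hD x hx y hy).le
    rcases lt_or_ge ‖x - y‖ ε with hlt | hge
    · rw [hfar x hx y hy hlt, abs_zero]
      positivity
    have hxy : x ≠ y := sub_ne_zero.1 (norm_pos_iff.1 (hε.trans_le hge))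
    have hk := refKernel_nonneg Ω s γ x y
    rw [div_mul_eq_mul_div, le_div_iff₀ (by positivity)]
    calc |K x y| * ε ^ γ ≤ C * refKernel Ω s γ x y * ‖x - y‖ ^ γ := by
          gcongr; exact hK.abs_le x hx y hy hxy
      _ = C * (refKernel Ω s γ x y * ‖x - y‖ ^ γ) := mul_assoc _ _ _
      _ ≤ C * (‖x - y‖ ^ (2 * s - n) * bdist Ω y ^ γ) := by
          exact mul_le_mul_of_nonneg_left (refKernel_mul_norm_rpow_le Ω s γ hxy) (by positivity)
      _ ≤ C * (P * bdist Ω y ^ γ) := by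
          gcongr; exact rpow_le_rpow_add_rpow hε hge (hD x hx y hy).le _
      _ = C * P * bdist Ω y ^ γ := (mul_assoc _ _ _).symm

theorem exists_split [Nonempty (Fin n)] (hK : IsDominatedKernel Ω s γ C K) (hC : 0 ≤ C)
    (hs : 0 < s) (hγ : 0 ≤ γ) (hΩ : MeasurableSet Ω) (hΩb : Bornology.IsBounded Ω) {η : ℝ}
    (hη : 0 < η) : ∃ (N F : E n → E n → ℝ) (M : ℝ≥0∞), M ≠ ⊤ ∧ M.toReal ≤ η ∧ K = N + F ∧
      IsSchurKernel (volume.restrict Ω) (fun x => bdist Ω x ^ γ) N M ∧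
      IsWeightBoundedKernel (volume.restrict Ω) (fun x => bdist Ω x ^ γ) F := by
  have hlim := ENNReal.Tendsto.const_mul (a := ENNReal.ofReal (2 ^ γ * C))
    (tendsto_rieszMeasure_ball (n := n) hs) (Or.inr ENNReal.ofReal_ne_top)
  rw [mul_zero] at hlim
  obtain ⟨r, hM, hr⟩ := ((hlim.eventually_lt_const (ENNReal.ofReal_pos.2 hη)).and
    self_mem_nhdsWithin).exists
  let S : Set (E n × E n) := {z | ‖z.1 - z.2‖ < r}
  have hS : MeasurableSet S := measurableSet_lt (by fun_prop) measurable_const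
  let N : E n → E n → ℝ := fun x y => S.indicator (fun z => K z.1 z.2) (x, y)
  let F : E n → E n → ℝ := fun x y => Sᶜ.indicator (fun z => K z.1 z.2) (x, y)
  have hN : IsDominatedKernel Ω s γ C N := hK.indicator hC hS
  have hF : IsDominatedKernel Ω s γ C F := hK.indicator hC hS.compl
  have hNF : K = N + F := funext₂ fun x y =>
    (congrFun (indicator_self_add_compl S fun z => K z.1 z.2) (x, y)).symm
  have hN0 (x y : E n) (hxy : r ≤ ‖x - y‖) : N x y = 0 :=
    indicator_of_notMem (show (x, y) ∉ S from not_lt.2 hxy) _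
  have hF0 (x y : E n) (hxy : ‖x - y‖ < r) : F x y = 0 :=
    indicator_of_notMem (notMem_compl_iff.2 (show (x, y) ∈ S from hxy)) _
  exact ⟨N, F, _, hM.ne_top, ENNReal.toReal_le_of_le_ofReal hη.le hM.le, hNF,
    hN.isSchurKernel hC hγ hΩ fun x _ y _ => hN0 x y,
    hF.isWeightBoundedKernel hC hγ hΩ hΩb hr fun x _ y _ => hF0 x y⟩

theorem exists_isSchurKernel [Nonempty (Fin n)] (hK : IsDominatedKernel Ω s γ C K) (hC : 0 ≤ C)
    (hs : 0 < s) (hγ : 0 ≤ γ) (hΩ : MeasurableSet Ω) (hΩb : Bornology.IsBounded Ω) :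
    ∃ M : ℝ≥0∞, M ≠ ⊤ ∧ IsSchurKernel (volume.restrict Ω) (fun x => bdist Ω x ^ γ) K M := by
  obtain ⟨D, hD⟩ := exists_norm_sub_lt hΩb
  exact ⟨_, ENNReal.mul_ne_top ENNReal.ofReal_ne_top (rieszMeasure_ball_ne_top hs D),
    hK.isSchurKernel hC hγ hΩ fun x hx y hy h => absurd h (hD x hx y hy).not_ge⟩

end IsDominatedKernel

end Domain

/-! ## Eigenbases and the resolvent series -/

section InfiniteDimensional

theorem not_finiteDimensional_Lp_two_of_pairwise_disjoint {α : Type*} [MeasurableSpace α]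
    {ν : Measure α} [IsFiniteMeasure ν] {V : ℕ → Set α} (hV : ∀ k, MeasurableSet (V k))
    (hpos : ∀ k, ν (V k) ≠ 0) (hdisj : Pairwise (Function.onFun Disjoint V)) :
    ¬ FiniteDimensional ℝ (Lp ℝ 2 ν) := by
  intro hfd
  let v : ℕ → Lp ℝ 2 ν := fun k => indicatorConstLp 2 (hV k) (measure_ne_top ν _) (1 : ℝ)
  have hinner (i k : ℕ) : inner ℝ (v i) (v k) = ν.real (V i ∩ V k) := by
    simp only [v, L2.inner_indicatorConstLp_indicatorConstLp, RCLike.inner_apply, map_one, mul_one,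
      smul_eq_mul]
  have hli : LinearIndependent ℝ v :=
    linearIndependent_of_ne_zero_of_inner_eq_zero (𝕜 := ℝ)
      (fun k hk => (ENNReal.toReal_pos (hpos k) (measure_ne_top ν _)).ne' (by
        have hkk := hinner k k
        rwa [hk, inner_zero_left, inter_self, eq_comm] at hkk))
      fun i k hik => (hinner i k).trans (by rw [(hdisj hik).inter_eq, measureReal_empty])
  exact not_finite_iff_infinite.2 inferInstance hli.finite

theorem not_finiteDimensional_Lp_two_restrict {X : Type*} [TopologicalSpace X] [T2Space X]
    [MeasurableSpace X] [OpensMeasurableSpace X] {μ : Measure X} [μ.IsOpenPosMeasure] {Ω : Set X}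
    [IsFiniteMeasure (μ.restrict Ω)] (hΩ : IsOpen Ω) (hinf : Ω.Infinite) :
    ¬ FiniteDimensional ℝ (Lp ℝ 2 (μ.restrict Ω)) := by
  have : Infinite Ω := hinf.to_subtype
  obtain ⟨U, hUi, hUo, hd⟩ := exists_seq_infinite_isOpen_pairwise_disjoint Ω
  have hV (k : ℕ) : IsOpen (Subtype.val '' U k) := hΩ.isOpenMap_subtype_val _ (hUo k)
  refine not_finiteDimensional_Lp_two_of_pairwise_disjoint (fun k => (hV k).measurableSet)
    (fun k => ?_) fun i k hik => (disjoint_image_iff Subtype.val_injective).2 (hd hik)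
  rw [Measure.restrict_apply (hV k).measurableSet,
    inter_eq_left.2 (Subtype.coe_image_subset Ω (U k))]
  exact ((hV k).measure_pos μ ((hUi k).nonempty.image _)).ne'

end InfiniteDimensional

section Eigenbasis

variable {n : ℕ} {Ω : Set (E n)} {L : L2 Ω →ₗ.[ℝ] L2 Ω} {G : E n → E n → ℝ}
  {A : L2 Ω →L[ℝ] L2 Ω}

namespace IsGreenFunction

theorem exists_domain (hG : IsGreenFunction Ω L G) (hA : IsKernelOp (volume.restrict Ω) G A)
    (f : L2 Ω) : ∃ u : L.domain, (u : L2 Ω) = A f ∧ L u = f := by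
  obtain ⟨u, hu, hLu⟩ := hG.right_inv f
  exact ⟨u, Lp.ext (hu.trans (hA f).2.symm), hLu⟩

theorem apply_apply (hG : IsGreenFunction Ω L G) (hA : IsKernelOp (volume.restrict Ω) G A)
    (u : L.domain) : A (L u) = u :=
  Lp.ext ((hA (L u)).2.trans (hG.left_inv u).symm)

theorem eigenvector_iff (hG : IsGreenFunction Ω L G) (hA : IsKernelOp (volume.restrict Ω) G A)
    {v : L2 Ω} {c : ℝ} (hc : c ≠ 0) :
    (∃ h : v ∈ L.domain, L ⟨v, h⟩ = c • v) ↔ A v = c⁻¹ • v := by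
  constructor
  · rintro ⟨h, hv⟩
    have hAv := hG.apply_apply hA ⟨v, h⟩
    rwa [hv, map_smul, ← eq_inv_smul_iff₀ hc] at hAv
  · intro hv
    obtain ⟨u, hu, hLu⟩ := hG.exists_domain hA v
    obtain rfl : v = (c • u : L.domain) := by
      rw [Submodule.coe_smul, hu, hv, smul_inv_smul₀ hc]
    exact ⟨(c • u).2, by rw [Subtype.coe_eta, L.map_smul, hLu]⟩

theorem exists_isEigenbasis (hG : IsGreenFunction Ω L G)
    (hA : IsKernelOp (volume.restrict Ω) G A) (hΩ : ¬ FiniteDimensional ℝ (L2 Ω))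
    (hL : ∀ u : L.domain, 0 ≤ inner ℝ (L u) (u : L2 Ω)) (hcomp : IsCompactOperator A)
    (hsymm : (A : L2 Ω →ₗ[ℝ] L2 Ω).IsSymmetric) :
    ∃ (lam : ℕ → ℝ) (φ : HilbertBasis ℕ ℝ (L2 Ω)), IsEigenbasis L lam φ := by
  have hinj : Function.Injective A := (injective_iff_map_eq_zero A).2 fun v hv => by
    obtain ⟨u, hu, rfl⟩ := hG.exists_domain hA v
    have hu0 : u = 0 := Subtype.ext (hu.trans hv)
    rw [hu0, L.map_zero]
  have hpos (v : L2 Ω) : 0 ≤ inner ℝ v (A v) := by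
    obtain ⟨u, hu, rfl⟩ := hG.exists_domain hA v
    exact hu ▸ hL u
  obtain ⟨lam, φ, hlam, hmono, htend, hφ⟩ :=
    exists_nat_hilbertBasis_eigenvectors hΩ hcomp hsymm hinj hpos
  exact ⟨lam, φ, hlam, hmono, htend, fun j => (hG.eigenvector_iff hA (hlam j).ne').2 (hφ j)⟩

end IsGreenFunction

end Eigenbasis

/-- The operator `Γ` on `L²(Ω)` is the sum of the series defining `𝔾_μ`. -/
def IsResolventSeries {n : ℕ} {Ω : Set (E n)} (lam : ℕ → ℝ) (φ : HilbertBasis ℕ ℝ (L2 Ω)) (μ : ℝ)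
    (Γ : L2 Ω →L[ℝ] L2 Ω) : Prop :=
  ∀ g, HasSum (resolventTerm lam φ μ g) (Γ g)

section ResolventSeries

variable {n : ℕ} {Ω : Set (E n)} {lam : ℕ → ℝ} {φ : HilbertBasis ℕ ℝ (L2 Ω)} {μ : ℝ}

theorem exists_isResolventSeries (φ : HilbertBasis ℕ ℝ (L2 Ω)) (hlam : Tendsto lam atTop atTop)
    (hμ : μ ∉ range lam) : ∃ Γ, IsResolventSeries lam φ μ Γ := by
  obtain ⟨d, hd, hle⟩ := exists_pos_forall_le_abs_sub hlam hμ
  obtain ⟨Γ, hΓ⟩ := exists_diagonal_clm φ (c := fun j => (lam j - μ)⁻¹) (inv_pos.2 hd).le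
    fun j => by
      rw [abs_inv]
      exact inv_anti₀ hd (hle j)
  exact ⟨Γ, fun g => (hΓ g).congr_fun fun j => by rw [resolventTerm, div_eq_inv_mul]⟩

namespace IsResolventSeries

variable {Γ : L2 Ω →L[ℝ] L2 Ω}

theorem resolventL2_eq (hΓ : IsResolventSeries lam φ μ Γ) (g : L2 Ω) :
    resolventL2 lam φ μ g = Γ g :=
  (hΓ g).tsum_eq

theorem inner_apply (hΓ : IsResolventSeries lam φ μ Γ) (g : L2 Ω) (j : ℕ) :
    inner ℝ (Γ g) (φ j) = inner ℝ g (φ j) / (lam j - μ) := by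
  have hsum : HasSum (fun i => inner ℝ (φ j) (resolventTerm lam φ μ g i)) (inner ℝ (φ j) (Γ g)) :=
    (hΓ g).mapL (innerSL ℝ (φ j))
  rw [real_inner_comm, hsum.unique (hasSum_single j fun i hij => ?_)]
  · rw [resolventTerm, inner_smul_right, real_inner_self_eq_norm_sq, φ.orthonormal.norm_eq_one,
      one_pow, mul_one]
  · rw [resolventTerm, inner_smul_right, φ.orthonormal.inner_eq_zero hij.symm, mul_zero]

theorem apply_basis (hΓ : IsResolventSeries lam φ μ Γ) (j : ℕ) :
    Γ (φ j) = (lam j - μ)⁻¹ • φ j := by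
  rw [(hΓ (φ j)).unique (hasSum_single j fun i hij => ?_)]
  · rw [resolventTerm, real_inner_self_eq_norm_sq, φ.orthonormal.norm_eq_one, one_pow, one_div]
  · rw [resolventTerm, φ.orthonormal.inner_eq_zero hij.symm, zero_div, zero_smul]

theorem isSymmetric (hΓ : IsResolventSeries lam φ μ Γ) :
    (Γ : L2 Ω →ₗ[ℝ] L2 Ω).IsSymmetric := by
  intro f g
  refine (φ.hasSum_inner_mul_inner (Γ f) g).unique
    ((φ.hasSum_inner_mul_inner f (Γ g)).congr_fun fun j => ?_)
  rw [hΓ.inner_apply, real_inner_comm (Γ g), hΓ.inner_apply, real_inner_comm g]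
  ring

theorem isResolventAt (hΓ : IsResolventSeries lam φ μ Γ) (hlam : ∀ j, lam j ≠ 0)
    (hμ : μ ∉ range lam) {A : L2 Ω →L[ℝ] L2 Ω} (hA : ∀ j, A (φ j) = (lam j)⁻¹ • φ j) :
    IsResolventAt A Γ μ := by
  have hid (j : ℕ) : (lam j - μ)⁻¹ - μ * ((lam j)⁻¹ * (lam j - μ)⁻¹) = (lam j)⁻¹ := by
    have hj := hlam j
    have hjμ : lam j - μ ≠ 0 := sub_ne_zero.2 fun h => hμ ⟨j, h⟩
    field_simp
  constructor <;> refine clm_ext_hilbertBasis φ fun j => ?_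
  · calc Γ (φ j) - μ • Γ (A (φ j))
        = ((lam j - μ)⁻¹ - μ * ((lam j)⁻¹ * (lam j - μ)⁻¹)) • φ j := by
          rw [hA, map_smul, hΓ.apply_basis]; module
      _ = A (φ j) := by rw [hid, hA]
  · calc Γ (φ j) - μ • A (Γ (φ j))
        = ((lam j - μ)⁻¹ - μ * ((lam j)⁻¹ * (lam j - μ)⁻¹)) • φ j := by
          rw [hΓ.apply_basis, map_smul, hA]; module
      _ = A (φ j) := by rw [hid, hA]

end IsResolventSeries

end ResolventSeries

/-! ## Realizations of the Green's operator -/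

/-- `K1` with the two-sided comparison of the kernel relaxed to an upper bound on its absolute
value: the Green's function may change sign. -/
structure HasDominatedGreen {n : ℕ} (Ω : Set (E n)) (s γ : ℝ) (L : L2 Ω →ₗ.[ℝ] L2 Ω)
    (G : E n → E n → ℝ) : Prop where
  nonneg : ∀ u : L.domain, 0 ≤ inner ℝ (L u) (u : L2 Ω)
  green : IsGreenFunction Ω L G
  symm : ∀ x ∈ Ω, ∀ y ∈ Ω, x ≠ y → G x y = G y x
  dominated : ∃ C, 0 ≤ C ∧ IsDominatedKernel Ω s γ C G

/-- `A` and `A'` are the integral operators with kernel `G` on `L²(Ω)` and on `L¹(Ω; δ^γ)`, and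
`j` is the inclusion of the former space in the latter; `A` is symmetric and the pair `(A, A')` is
smoothing. -/
structure IsGreenRealization {n : ℕ} {Ω : Set (E n)} {γ : ℝ} (G : E n → E n → ℝ)
    (j : L2 Ω →L[ℝ] WL1 Ω γ) (A : L2 Ω →L[ℝ] L2 Ω) (A' : WL1 Ω γ →L[ℝ] WL1 Ω γ) : Prop where
  isWeight : IsWeight (volume.restrict Ω) (weightedMeasure Ω γ) fun x => bdist Ω x ^ γ
  coe_inclusion : ∀ g, j g =ᵐ[volume.restrict Ω] g
  isKernelOp_two : IsKernelOp (volume.restrict Ω) G A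
  isKernelOp_one : IsKernelOp (volume.restrict Ω) G A'
  isSmoothingPair : IsSmoothingPair j A A'
  isSymmetric : (A : L2 Ω →ₗ[ℝ] L2 Ω).IsSymmetric

section Realization

variable {n : ℕ} {Ω : Set (E n)} {s γ : ℝ} {L : L2 Ω →ₗ.[ℝ] L2 Ω} {G : E n → E n → ℝ}

theorem K1.hasDominatedGreen (hK : K1 Ω s γ L G) : HasDominatedGreen Ω s γ L G where
  nonneg := hK.nonneg
  green := hK.green
  symm := hK.symm
  dominated := by
    obtain ⟨C, hC, hCG⟩ := hK.comparable
    refine ⟨C, hC.le, hK.measurable, fun x hx y hy hxy => ?_⟩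
    rw [abs_of_pos (hK.pos x hx y hy hxy)]
    exact (hCG x hx y hy hxy).2

theorem HasDominatedGreen.exists_isGreenRealization [Nonempty (Fin n)]
    (hG : HasDominatedGreen Ω s γ L G) (hs : 0 < s) (hγ : 0 ≤ γ) (hΩo : IsOpen Ω)
    (hΩb : Bornology.IsBounded Ω) :
    ∃ (j : L2 Ω →L[ℝ] WL1 Ω γ) (A : L2 Ω →L[ℝ] L2 Ω) (A' : WL1 Ω γ →L[ℝ] WL1 Ω γ),
      IsGreenRealization G j A A' := by
  have := isFiniteMeasure_restrict_of_isBounded hΩb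
  have hΩ := hΩo.measurableSet
  have hw := isWeight_bdist_rpow hΩo hΩb hγ
  obtain ⟨j, hj⟩ := hw.exists_inclusion
  obtain ⟨C, hC, hdom⟩ := hG.dominated
  obtain ⟨M, hM, hSchur⟩ := hdom.exists_isSchurKernel hC hs hγ hΩ hΩb
  obtain ⟨A, -, hA⟩ := hSchur.exists_operator_two hM
  obtain ⟨A', -, hA'⟩ := hSchur.exists_operator_one hw hM
  have hsymm : ∀ᵐ x ∂volume.restrict Ω, ∀ᵐ y ∂volume.restrict Ω, G y x = G x y := by
    filter_upwards [ae_restrict_mem hΩ] with x hx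
    filter_upwards [ae_restrict_mem hΩ, ae_restrict_of_ae (Measure.ae_ne volume x)] with y hy hyx
    exact hG.symm y hy x hx hyx
  exact ⟨j, A, A', hw, hj, hA, hA',
    isSmoothingPair_of_split hw hj hA hA' fun η hη => hdom.exists_split hC hs hγ hΩ hΩb hη,
    hSchur.isSymmetric hM hsymm hA⟩

end Realization

/-! ## Test functions -/

/-- A class of test functions contained in `δ^γ L^∞(Ω)` which separates the points of
`L¹(Ω; δ^γ)`. -/
structure IsTestClass {n : ℕ} (Ω : Set (E n)) (γ : ℝ) (𝒯 : (E n → ℝ) → Prop) : Prop where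
  isWeightBounded : ∀ ψ, 𝒯 ψ → IsWeightBounded (volume.restrict Ω) (fun x => bdist Ω x ^ γ) ψ
  separating : ∀ v : WL1 Ω γ, (∀ ψ, 𝒯 ψ → ∫ x in Ω, v x * ψ x = 0) → v = 0

section TestFunctions

variable {n : ℕ} {Ω : Set (E n)} {γ : ℝ} {ψ : E n → ℝ}

theorem IsTestClass.mono {𝒯 𝒯' : (E n → ℝ) → Prop} (h𝒯 : IsTestClass Ω γ 𝒯)
    (hle : ∀ ψ, 𝒯 ψ → 𝒯' ψ)
    (hb : ∀ ψ, 𝒯' ψ → IsWeightBounded (volume.restrict Ω) (fun x => bdist Ω x ^ γ) ψ) :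
    IsTestClass Ω γ 𝒯' :=
  ⟨hb, fun v hv => h𝒯.separating v fun ψ hψ => hv ψ (hle ψ hψ)⟩

theorem MemSmoothC.memLinftyC (hψ : MemSmoothC Ω ψ) : MemLinftyC Ω ψ where
  meas := hψ.smooth.continuous.aestronglyMeasurable
  bounded := by
    obtain ⟨C, hC⟩ := hψ.compact.exists_bound_of_continuous hψ.smooth.continuous
    exact ⟨C, Eventually.of_forall hC⟩
  support := ⟨tsupport ψ, hψ.compact, hψ.support, Eventually.of_forall fun x hx =>
    image_eq_zero_of_notMem_tsupport hx⟩

theorem memLinftyC_indicator_one {K : Set (E n)} (hK : IsCompact K) (hKΩ : K ⊆ Ω) :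
    MemLinftyC Ω (K.indicator 1) where
  meas := (measurable_one.indicator hK.measurableSet).aestronglyMeasurable
  bounded := ⟨1, Eventually.of_forall fun x => by
    by_cases hx : x ∈ K <;> simp [hx]⟩
  support := ⟨K, hK, hKΩ, Eventually.of_forall fun x hx => indicator_of_notMem hx _⟩

theorem ae_eq_zero_of_forall_integral_smooth_mul_eq_zero (hΩ : IsOpen Ω) {v : E n → ℝ}
    (hv : LocallyIntegrableOn v Ω)
    (h : ∀ ψ : E n → ℝ, MemSmoothC Ω ψ → ∫ x in Ω, v x * ψ x = 0) : v =ᵐ[volume.restrict Ω] 0 := by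
  rw [EventuallyEq, ae_restrict_iff' hΩ.measurableSet]
  refine hΩ.ae_eq_zero_of_integral_contDiff_smul_eq_zero hv fun ψ hψ hψc hψΩ => ?_
  rw [← h ψ ⟨hψ, hψc, hψΩ⟩, setIntegral_eq_integral_of_forall_compl_eq_zero]
  · simp only [smul_eq_mul, mul_comm]
  · intro x hx
    rw [image_eq_zero_of_notMem_tsupport fun hxψ => hx (hψΩ hxψ), mul_zero]

variable [Nonempty (Fin n)]

theorem exists_pos_forall_le_bdist_rpow (hΩo : IsOpen Ω) (hΩb : Bornology.IsBounded Ω) (γ : ℝ)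
    {K : Set (E n)} (hK : IsCompact K) (hKΩ : K ⊆ Ω) : ∃ c > 0, ∀ x ∈ K, c ≤ bdist Ω x ^ γ := by
  rcases K.eq_empty_or_nonempty with rfl | hne
  · exact ⟨1, one_pos, fun x hx => hx.elim⟩
  have hpos (x : E n) (hx : x ∈ K) : 0 < bdist Ω x := bdist_pos hΩo hΩb (hKΩ hx)
  have hcont : ContinuousOn (fun x => bdist Ω x ^ γ) K :=
    (Metric.continuous_infDist_pt _).continuousOn.rpow_const fun x hx => Or.inl (hpos x hx).ne'
  obtain ⟨z, hz, hmin⟩ := hK.exists_isMinOn hne hcont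
  exact ⟨bdist Ω z ^ γ, Real.rpow_pos_of_pos (hpos z hz) γ, hmin⟩

theorem MemLinftyC.isWeightBounded (hΩo : IsOpen Ω) (hΩb : Bornology.IsBounded Ω)
    (hψ : MemLinftyC Ω ψ) :
    IsWeightBounded (volume.restrict Ω) (fun x => bdist Ω x ^ γ) ψ := by
  obtain ⟨M, hM⟩ := hψ.bounded
  obtain ⟨K, hK, hKΩ, hKψ⟩ := hψ.support
  obtain ⟨c, hc, hcK⟩ := exists_pos_forall_le_bdist_rpow hΩo hΩb γ hK hKΩ
  refine ⟨hψ.meas, |M| / c, ?_⟩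
  filter_upwards [hM, hKψ] with x hxM hxK
  by_cases hx : x ∈ K
  · calc |ψ x| ≤ |M| := hxM.trans (le_abs_self M)
      _ = |M| / c * c := (div_mul_cancel₀ _ hc.ne').symm
      _ ≤ |M| / c * bdist Ω x ^ γ := by gcongr; exact hcK x hx
  · rw [hxK hx, abs_zero]
    have := Real.rpow_nonneg (bdist_nonneg Ω x) γ
    positivity

theorem locallyIntegrableOn_coe_WL1 (hΩo : IsOpen Ω) (hΩb : Bornology.IsBounded Ω) (hγ : 0 ≤ γ)
    (v : WL1 Ω γ) : LocallyIntegrableOn v Ω := by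
  rw [locallyIntegrableOn_iff hΩo.isLocallyClosed]
  intro K hKΩ hK
  have hint := ((memLinftyC_indicator_one hK hKΩ).isWeightBounded hΩo hΩb).integrable_mul
    (isWeight_bdist_rpow hΩo hΩb hγ) v
  have hind : (fun x => v x * K.indicator 1 x) = K.indicator v := by
    ext x
    by_cases hx : x ∈ K <;> simp [hx]
  rwa [hind, integrable_indicator_iff hK.measurableSet, IntegrableOn,
    Measure.restrict_restrict hK.measurableSet, inter_eq_left.2 hKΩ] at hint

theorem isTestClass_memSmoothC (hΩo : IsOpen Ω) (hΩb : Bornology.IsBounded Ω) (hγ : 0 ≤ γ) :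
    IsTestClass Ω γ (MemSmoothC Ω) where
  isWeightBounded ψ hψ := hψ.memLinftyC.isWeightBounded hΩo hΩb
  separating v hv := by
    have hw := isWeight_bdist_rpow hΩo hΩb hγ
    have hv0 : v =ᵐ[volume.restrict Ω] 0 := ae_eq_zero_of_forall_integral_smooth_mul_eq_zero hΩo
      (locallyIntegrableOn_coe_WL1 hΩo hΩb hγ v) hv
    exact Lp.eq_zero_iff_ae_eq_zero.2 (hw.absolutelyContinuous.ae_le hv0)

theorem isTestClass_memLinftyC (hΩo : IsOpen Ω) (hΩb : Bornology.IsBounded Ω) (hγ : 0 ≤ γ) :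
    IsTestClass Ω γ (MemLinftyC Ω) :=
  (isTestClass_memSmoothC hΩo hΩb hγ).mono (fun _ hψ => hψ.memLinftyC)
    fun _ hψ => hψ.isWeightBounded hΩo hΩb

theorem isTestClass_isWeightBounded (hΩo : IsOpen Ω) (hΩb : Bornology.IsBounded Ω) (hγ : 0 ≤ γ) :
    IsTestClass Ω γ (IsWeightBounded (volume.restrict Ω) fun x => bdist Ω x ^ γ) :=
  (isTestClass_memLinftyC hΩo hΩb hγ).mono (fun _ hψ => hψ.isWeightBounded hΩo hΩb) fun _ => id

end TestFunctions

/-! ## Notions of solution -/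

section Solutions

variable {n : ℕ} {Ω : Set (E n)} {γ : ℝ} {G : E n → E n → ℝ} {j : L2 Ω →L[ℝ] WL1 Ω γ}
  {A Γ : L2 Ω →L[ℝ] L2 Ω} {A' T : WL1 Ω γ →L[ℝ] WL1 Ω γ} {lam : ℕ → ℝ}
  {φ : HilbertBasis ℕ ℝ (L2 Ω)} {μ : ℝ} {ψ : E n → ℝ}

theorem greenOp_congr_ae (G : E n → E n → ℝ) {f g : E n → ℝ} (h : f =ᵐ[volume.restrict Ω] g) :
    greenOp Ω G f = greenOp Ω G g :=
  funext fun x => integral_congr_ae <| by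
    filter_upwards [h] with y hy
    rw [hy]

theorem isSpectralSol_iff (hΓ : IsResolventSeries lam φ μ Γ) (hμ : μ ∉ range lam) {f u : E n → ℝ}
    {f₂ u₂ : L2 Ω} (hf : f =ᵐ[volume.restrict Ω] f₂) (hu : u =ᵐ[volume.restrict Ω] u₂) :
    IsSpectralSol lam φ μ f u ↔ u₂ = Γ f₂ := by
  have hne (k : ℕ) : lam k - μ ≠ 0 := sub_ne_zero.2 fun h => hμ ⟨k, h⟩
  simp only [IsSpectralSol, ← inner_eq_integral_of_ae_eq hf, ← inner_eq_integral_of_ae_eq hu]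
  constructor
  · intro h
    refine φ.repr.injective (lp.ext (funext fun k => ?_))
    rw [φ.repr_apply_apply, φ.repr_apply_apply, real_inner_comm, real_inner_comm (Γ f₂),
      hΓ.inner_apply, eq_div_iff (hne k), mul_comm, h k]
  · rintro rfl k
    rw [hΓ.inner_apply, mul_div_cancel₀ _ (hne k)]

namespace IsGreenRealization

theorem isResolventExtension_iff (h : IsGreenRealization G j A A')
    (hΓ : IsResolventSeries lam φ μ Γ) : IsResolventExtension lam φ μ T ↔ T ∘L j = j ∘L Γ := by
  constructor
  · intro hT
    ext1 g
    have hTg := hT g (j g) (h.coe_inclusion g)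
    rw [hΓ.resolventL2_eq] at hTg
    exact h.isWeight.ext_iff_ae.2 (hTg.trans (h.coe_inclusion (Γ g)).symm)
  · intro hT g g' hg
    obtain rfl : g' = j g := h.isWeight.ext_iff_ae.2 (hg.trans (h.coe_inclusion g).symm)
    have hTg : T (j g) = j (Γ g) := DFunLike.congr_fun hT g
    rw [hΓ.resolventL2_eq, hTg]
    exact h.coe_inclusion (Γ g)

theorem isResolventGreenSol_iff (h : IsGreenRealization G j A A') {f u : WL1 Ω γ} :
    IsResolventGreenSol T f u ↔ u = T f :=
  h.isWeight.ext_iff_ae.symm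

theorem isGreenSol_iff (h : IsGreenRealization G j A A') {f u : WL1 Ω γ} :
    IsGreenSol G μ f u ↔ u = μ • A' u + A' f := by
  have hA' : (μ • A' u + A' f : WL1 Ω γ) =ᵐ[volume.restrict Ω]
      fun x => μ * greenOp Ω G u x + greenOp Ω G f x := by
    have hac := h.isWeight.absolutelyContinuous'.ae_le
    filter_upwards [hac (Lp.coeFn_add (μ • A' u) (A' f)), hac (Lp.coeFn_smul μ (A' u)),
      (h.isKernelOp_one u).2, (h.isKernelOp_one f).2] with x hadd hsmul hu hf
    rw [hadd, Pi.add_apply, hsmul, Pi.smul_apply, hu, hf, smul_eq_mul, greenOp, greenOp]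
  rw [h.isWeight.ext_iff_ae]
  exact ⟨fun hsol => EventuallyEq.trans hsol.2.2 hA'.symm,
    fun hsol => ⟨(h.isKernelOp_one u).1, (h.isKernelOp_one f).1, hsol.trans hA'⟩⟩

theorem apply_ae_eq_greenOp (h : IsGreenRealization G j A A') {ψ₂ : L2 Ω}
    (hψ : ψ =ᵐ[volume.restrict Ω] ψ₂) : A ψ₂ =ᵐ[volume.restrict Ω] greenOp Ω G ψ :=
  greenOp_congr_ae G hψ ▸ (h.isKernelOp_two ψ₂).2

theorem isSpectralSol_iff (h : IsGreenRealization G j A A') (hΓ : IsResolventSeries lam φ μ Γ)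
    (hμ : μ ∉ range lam) (hT : T ∘L j = j ∘L Γ) {f u : WL1 Ω γ}
    (hf : MemLp f 2 (volume.restrict Ω)) (hu : MemLp u 2 (volume.restrict Ω)) :
    IsSpectralSol lam φ μ f u ↔ u = T f := by
  have hjf : f = j hf.toLp :=
    h.isWeight.ext_iff_ae.2 (hf.coeFn_toLp.symm.trans (h.coe_inclusion _).symm)
  have hTj : T (j hf.toLp) = j (Γ hf.toLp) := DFunLike.congr_fun hT _
  have hTf : T f =ᵐ[volume.restrict Ω] Γ hf.toLp :=
    ((congrArg T hjf).trans hTj).symm ▸ h.coe_inclusion _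
  rw [GreenNotions.isSpectralSol_iff hΓ hμ hf.coeFn_toLp.symm hu.coeFn_toLp.symm,
    h.isWeight.ext_iff_ae]
  exact ⟨fun hsol => hu.coeFn_toLp.symm.trans (hsol ▸ hTf.symm),
    fun hsol => Lp.ext (hu.coeFn_toLp.trans (hsol.trans hTf))⟩

variable [IsFiniteMeasure (volume.restrict Ω)]

theorem existsUnique_isResolventExtension (h : IsGreenRealization G j A A')
    (hΓ : IsResolventSeries lam φ μ Γ) (hres : IsResolventAt A Γ μ) :
    ∃! T, IsResolventExtension (γ := γ) lam φ μ T := by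
  obtain ⟨T, hT⟩ := h.isSmoothingPair.exists_extension hres
  refine ⟨T, (h.isResolventExtension_iff hΓ).2 hT, fun T' hT' => ?_⟩
  have hTT' : T' ∘L j = T ∘L j := ((h.isResolventExtension_iff hΓ).1 hT').trans hT.symm
  exact DFunLike.coe_injective ((h.isWeight.denseRange_inclusion h.coe_inclusion).equalizer
    T'.continuous T.continuous (congrArg DFunLike.coe hTT'))

theorem isResolventAt (h : IsGreenRealization G j A A') (hres : IsResolventAt A Γ μ)
    (hT : T ∘L j = j ∘L Γ) : IsResolventAt A' T μ :=
  hres.of_denseRange (h.isWeight.denseRange_inclusion h.coe_inclusion)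
    h.isSmoothingPair.intertwines hT

theorem isResolventWeakSol_iff (h : IsGreenRealization G j A A')
    (h𝒯 : IsTestClass Ω γ (IsWeightBounded (volume.restrict Ω) fun x => bdist Ω x ^ γ))
    (hΓ : IsResolventSeries lam φ μ Γ) (hT : T ∘L j = j ∘L Γ) {f u : WL1 Ω γ} :
    IsResolventWeakSol lam φ μ f u ↔ u = T f := by
  have hdual {ψ : L2 Ω} (hψ : IsWeightBounded (volume.restrict Ω) (fun x => bdist Ω x ^ γ) ψ) :
      ∫ x in Ω, T f x * ψ x = ∫ x in Ω, f x * Γ ψ x :=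
    hψ.integral_apply_mul h.isWeight h.coe_inclusion hT hΓ.isSymmetric f
  constructor
  · intro hsol
    refine sub_eq_zero.1 (h𝒯.separating _ fun ψ hψ => ?_)
    obtain ⟨ψ₂, hψψ₂, hψ₂⟩ := hψ.exists_Lp_two h.isWeight
    obtain ⟨-, -, heq⟩ := hsol ψ₂ hψ₂.2
    obtain ⟨Λ, hΛ⟩ := hψ₂.exists_functional h.isWeight
    rw [hΓ.resolventL2_eq, ← hdual hψ₂, ← hΛ, ← hΛ] at heq
    calc ∫ x in Ω, (u - T f) x * ψ x = Λ (u - T f) := by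
          rw [hΛ]
          refine integral_congr_ae ?_
          filter_upwards [hψψ₂] with x hx
          rw [hx]
      _ = 0 := by rw [map_sub, heq, sub_self]
  · rintro rfl ψ hψ
    have hψb : IsWeightBounded _ _ ψ := ⟨Lp.aestronglyMeasurable ψ, hψ⟩
    rw [hΓ.resolventL2_eq]
    exact ⟨hψb.integrable_mul h.isWeight _,
      (hψb.of_intertwines h.isWeight h.coe_inclusion hT hΓ.isSymmetric).integrable_mul h.isWeight f,
      hdual hψb⟩

theorem isWeightBounded_greenOp (h : IsGreenRealization G j A A')
    (hψ : IsWeightBounded (volume.restrict Ω) (fun x => bdist Ω x ^ γ) ψ) :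
    IsWeightBounded (volume.restrict Ω) (fun x => bdist Ω x ^ γ) (greenOp Ω G ψ) := by
  obtain ⟨ψ₂, hψψ₂, hψ₂⟩ := hψ.exists_Lp_two h.isWeight
  exact (hψ₂.of_intertwines h.isWeight h.coe_inclusion h.isSmoothingPair.intertwines
    h.isSymmetric).congr (h.apply_ae_eq_greenOp hψψ₂)

theorem integral_apply_mul (h : IsGreenRealization G j A A')
    (hψ : IsWeightBounded (volume.restrict Ω) (fun x => bdist Ω x ^ γ) ψ) (f : WL1 Ω γ) :
    ∫ x in Ω, A' f x * ψ x = ∫ x in Ω, f x * greenOp Ω G ψ x := by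
  obtain ⟨ψ₂, hψψ₂, hψ₂⟩ := hψ.exists_Lp_two h.isWeight
  calc ∫ x in Ω, A' f x * ψ x = ∫ x in Ω, A' f x * ψ₂ x := integral_congr_ae <| by
        filter_upwards [hψψ₂] with x hx
        rw [hx]
    _ = ∫ x in Ω, f x * A ψ₂ x := hψ₂.integral_apply_mul h.isWeight h.coe_inclusion
        h.isSmoothingPair.intertwines h.isSymmetric f
    _ = ∫ x in Ω, f x * greenOp Ω G ψ x := integral_congr_ae <| by
        filter_upwards [h.apply_ae_eq_greenOp hψψ₂] with x hx
        rw [hx]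

theorem integral_residual_mul (h : IsGreenRealization G j A A')
    (hψ : IsWeightBounded (volume.restrict Ω) (fun x => bdist Ω x ^ γ) ψ) (μ : ℝ)
    (f u : WL1 Ω γ) :
    ∫ x in Ω, (u - (μ • A' u + A' f)) x * ψ x =
      (∫ x in Ω, u x * (ψ x - μ * greenOp Ω G ψ x)) - ∫ x in Ω, f x * greenOp Ω G ψ x := by
  obtain ⟨Λ, hΛ⟩ := hψ.exists_functional h.isWeight
  have hu : ∫ x in Ω, u x * (ψ x - μ * greenOp Ω G ψ x) = Λ u - μ * Λ (A' u) := by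
    rw [hΛ, hΛ, h.integral_apply_mul hψ, ← integral_const_mul, ← integral_sub
      (hψ.integrable_mul h.isWeight u)
      (((h.isWeightBounded_greenOp hψ).integrable_mul h.isWeight u).const_mul μ)]
    simp only [mul_sub, mul_left_comm μ]
  rw [hu, ← h.integral_apply_mul hψ f, ← hΛ, ← hΛ, map_sub, map_add, map_smul, smul_eq_mul]
  ring

theorem isGreenWeakSol_iff (h : IsGreenRealization G j A A') {𝒯 : (E n → ℝ) → Prop}
    (h𝒯 : IsTestClass Ω γ 𝒯) {f u : WL1 Ω γ} :
    IsGreenWeakSol G 𝒯 μ f u ↔ u = μ • A' u + A' f := by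
  constructor
  · intro hsol
    refine sub_eq_zero.1 (h𝒯.separating _ fun ψ hψ => ?_)
    rw [h.integral_residual_mul (h𝒯.isWeightBounded ψ hψ), (hsol ψ hψ).2.2, sub_self]
  · intro hsol ψ hψ
    have hψb := h𝒯.isWeightBounded ψ hψ
    have hGψ := h.isWeightBounded_greenOp hψb
    refine ⟨?_, hGψ.integrable_mul h.isWeight f, ?_⟩
    · simp only [mul_sub, mul_left_comm _ μ]
      exact (hψb.integrable_mul h.isWeight u).sub ((hGψ.integrable_mul h.isWeight u).const_mul μ)
    · obtain ⟨Λ, hΛ⟩ := hψb.exists_functional h.isWeight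
      rw [← sub_eq_zero, ← h.integral_residual_mul hψb, sub_eq_zero.2 hsol, ← hΛ, map_zero]

end IsGreenRealization

end Solutions

end GreenNotions

open GreenNotions in
theorem mainTheorem7_general {n : ℕ} (hn : 1 ≤ n) {s γ : ℝ} (hs : 0 < s) (hγ : 0 ≤ γ)
    {Ω : Set (E n)} (hΩo : IsOpen Ω) (hΩb : Bornology.IsBounded Ω) (hΩn : Ω.Nonempty)
    {L : L2 Ω →ₗ.[ℝ] L2 Ω} {G : E n → E n → ℝ} (hG : HasDominatedGreen Ω s γ L G) :
    (∀ g : WL1 Ω γ, GreenDefined Ω G g) ∧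
    (∃ (lam : ℕ → ℝ) (φ : HilbertBasis ℕ ℝ (L2 Ω)), IsEigenbasis L lam φ) ∧
    ∀ (lam : ℕ → ℝ) (φ : HilbertBasis ℕ ℝ (L2 Ω)), IsEigenbasis L lam φ →
      ∀ μ : ℝ, μ ∉ range lam →
      (∀ g : L2 Ω, Summable (resolventTerm lam φ μ g)) ∧
      (∃! T : WL1 Ω γ →L[ℝ] WL1 Ω γ, IsResolventExtension lam φ μ T) ∧
      ∀ T : WL1 Ω γ →L[ℝ] WL1 Ω γ, IsResolventExtension lam φ μ T → ∀ f u : WL1 Ω γ,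
        [IsResolventGreenSol T f u, IsResolventWeakSol lam φ μ f u,
          IsGreenWeakSol G (MemLinftyC Ω) μ f u, IsGreenWeakSol G (MemSmoothC Ω) μ f u,
          IsGreenSol G μ f u].TFAE ∧
        (MemLp f 2 (volume.restrict Ω) → MemLp u 2 (volume.restrict Ω) →
          [IsResolventGreenSol T f u, IsResolventWeakSol lam φ μ f u,
            IsGreenWeakSol G (MemLinftyC Ω) μ f u, IsGreenWeakSol G (MemSmoothC Ω) μ f u,
            IsGreenSol G μ f u, IsSpectralSol lam φ μ f u].TFAE) := by
  have : Nonempty (Fin n) := ⟨⟨0, hn⟩⟩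
  have := isFiniteMeasure_restrict_of_isBounded hΩb
  have hΩinf : Ω.Infinite := infinite_of_mem_nhds _ (hΩo.mem_nhds hΩn.some_mem)
  obtain ⟨j, A, A', h⟩ := hG.exists_isGreenRealization hs hγ hΩo hΩb
  refine ⟨fun g => (h.isKernelOp_one g).1, hG.green.exists_isEigenbasis h.isKernelOp_two
    (not_finiteDimensional_Lp_two_restrict hΩo hΩinf) hG.nonneg
    h.isSmoothingPair.isCompactOperator h.isSymmetric, fun lam φ hφ μ hμ => ?_⟩
  obtain ⟨Γ, hΓ⟩ := exists_isResolventSeries φ hφ.tendsto hμ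
  have hres : IsResolventAt A Γ μ := hΓ.isResolventAt (fun k => (hφ.pos k).ne') hμ fun k =>
    (hG.green.eigenvector_iff h.isKernelOp_two (hφ.pos k).ne').1 (hφ.eigen k)
  refine ⟨fun g => (hΓ g).summable, h.existsUnique_isResolventExtension hΓ hres,
    fun T hT f u => ?_⟩
  have hTj : T ∘L j = j ∘L Γ := (h.isResolventExtension_iff hΓ).1 hT
  have hfix : u = T f ↔ u = μ • A' u + A' f := (h.isResolventAt hres hTj).eq_apply_iff
  have h₁ : IsResolventGreenSol T f u ↔ u = T f := h.isResolventGreenSol_iff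
  have h₂ := h.isResolventWeakSol_iff (isTestClass_isWeightBounded hΩo hΩb hγ) hΓ hTj
    (f := f) (u := u)
  have h₃ := (h.isGreenWeakSol_iff (isTestClass_memLinftyC hΩo hΩb hγ)).trans hfix.symm
  have h₄ := (h.isGreenWeakSol_iff (isTestClass_memSmoothC hΩo hΩb hγ)).trans hfix.symm
  have h₅ : IsGreenSol G μ f u ↔ u = T f := h.isGreenSol_iff.trans hfix.symm
  refine ⟨List.tfae_of_forall (u = T f) _ ?_, fun hf hu => List.tfae_of_forall (u = T f) _ ?_⟩
  · simp [h₁, h₂, h₃, h₄, h₅]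
  · simp [h₁, h₂, h₃, h₄, h₅, h.isSpectralSol_iff hΓ hμ hTj hf hu]

theorem mainTheorem7 (n : ℕ) (hn : 1 ≤ n) (s γ : ℝ) (hs : s ∈ Set.Ioo (0 : ℝ) 1)
    (hγ : γ ∈ Set.Ioc (0 : ℝ) 1) (hns : (n : ℝ) ≠ 2 * s)
    (Ω : Set (GreenNotions.E n)) (hΩo : IsOpen Ω) (hΩb : Bornology.IsBounded Ω)
    (hΩn : Ω.Nonempty)
    (L : GreenNotions.L2 Ω →ₗ.[ℝ] GreenNotions.L2 Ω)
    (G : GreenNotions.E n → GreenNotions.E n → ℝ) (hK1 : GreenNotions.K1 Ω s γ L G) :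
    -- `𝔾₀` is defined on `L¹(Ω; δ^γ)`, and a standard eigenbasis exists
    (∀ g : GreenNotions.WL1 Ω γ, GreenNotions.GreenDefined Ω G g) ∧
    (∃ (lam : ℕ → ℝ) (φ : HilbertBasis ℕ ℝ (GreenNotions.L2 Ω)),
      GreenNotions.IsEigenbasis L lam φ) ∧
    -- for every eigenbasis and every `μ` outside the spectrum
    ∀ (lam : ℕ → ℝ) (φ : HilbertBasis ℕ ℝ (GreenNotions.L2 Ω)),
      GreenNotions.IsEigenbasis L lam φ → ∀ μ : ℝ, μ ∉ Set.range lam →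
      -- `𝔾_μ` is defined on `L²(Ω)` and has a unique bounded extension to `L¹(Ω; δ^γ)`
      (∀ g : GreenNotions.L2 Ω, Summable (GreenNotions.resolventTerm lam φ μ g)) ∧
      (∃! T : GreenNotions.WL1 Ω γ →L[ℝ] GreenNotions.WL1 Ω γ,
        GreenNotions.IsResolventExtension lam φ μ T) ∧
      ∀ T : GreenNotions.WL1 Ω γ →L[ℝ] GreenNotions.WL1 Ω γ,
        GreenNotions.IsResolventExtension lam φ μ T →
        ∀ f u : GreenNotions.WL1 Ω γ,
          -- the five notions are equivalent
          [GreenNotions.IsResolventGreenSol T f u,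
            GreenNotions.IsResolventWeakSol lam φ μ f u,
            GreenNotions.IsGreenWeakSol G (GreenNotions.MemLinftyC Ω) μ f u,
            GreenNotions.IsGreenWeakSol G (GreenNotions.MemSmoothC Ω) μ f u,
            GreenNotions.IsGreenSol G μ f u].TFAE ∧
          -- and, in the `L²` setting, equivalent to being a spectral solution
          (MeasureTheory.MemLp f 2 (MeasureTheory.volume.restrict Ω) →
            GreenNotions.MemH2 lam φ u →
            [GreenNotions.IsResolventGreenSol T f u,
              GreenNotions.IsResolventWeakSol lam φ μ f u,
              GreenNotions.IsGreenWeakSol G (GreenNotions.MemLinftyC Ω) μ f u,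
              GreenNotions.IsGreenWeakSol G (GreenNotions.MemSmoothC Ω) μ f u,
              GreenNotions.IsGreenSol G μ f u,
              GreenNotions.IsSpectralSol lam φ μ f u].TFAE) := by
  have hmain := mainTheorem7_general hn hs.1 hγ.1.le hΩo hΩb hΩn hK1.hasDominatedGreen
  exact ⟨hmain.1, hmain.2.1, fun lam φ hφ μ hμ =>
    ⟨(hmain.2.2 lam φ hφ μ hμ).1, (hmain.2.2 lam φ hφ μ hμ).2.1, fun T hT f u =>
      ((hmain.2.2 lam φ hφ μ hμ).2.2 T hT f u).imp_right fun htfae hf hu => htfae hf hu.1⟩⟩
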